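/- Let $I=(0,2\pi)$, $\Pi=I\times(0,\infty)$, $\Pi_\xi=I\times(0,\xi)$ for $\xi>0$, let $X$ be a Banach space (real or complex), and let $1<p<\infty$. Let $L^{p,1}(\Pi;X)$ be the space of strongly measurable $u:\Pi\to X$ with $\int_0^\infty\big(\int_0^{2\pi}\|u(x,y)\|_X^p\,dx\big)^{1/p}dy<\infty$, and let $W^m_{p,1}(\Pi;X)$ be the space of functions whose weak derivatives up to order $m$ exist and belong to $L^{p,1}(\Pi;X)$, normed by the sum of the $L^{p,1}$-norms of these derivatives; define $W^m_{p,1}(\Pi_\xi;X)$ likewise with $y$ ranging over $(0,\xi)$. Let $\Gamma_{J_0},\Gamma_{J_{2\pi}}:W^1_{p,1}(\Pi;X)\to L^1_{\rm loc}([0,\infty);X)$ be the trace operators on the half-lines $J_0=\{0\}\times(0,\infty)$ and $J_{2\pi}=\{2\pi\}\times(0,\infty)$, and let $\Gamma_I:W^1_{p,1}(\Pi;X)\to L^p(I;X)$ be the trace operator on $I\times\{0\}$. That is, for every $\xi>0$ they are induced by the continuous extensions to $W^1_{p,1}(\Pi_\xi;X)$, with values in $L^1((0,\xi);X)$ and $L^p(I;X)$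 respectively, of the restriction maps $v\mapsto v(0,\cdot)$, $v\mapsto v(2\pi,\cdot)$ and $v\mapsto v(\cdot,0)$ on $W^1_{p,1}(\Pi_\xi;X)\cap C(\overline{\Pi_\xi};X)$. **Theorem (Uniqueness).** Let $f\in W^2_p(I;X)$. Then the problem $$\begin{cases}\Delta u=0 & \text{a.e. in }\Pi,\\ \Gamma_I u=f & \text{on } I,\\ \Gamma_{J_0}u(0,y)=\Gamma_{J_{2\pi}}u(2\pi,y) & \text{for a.e. } y\in(0,\infty),\\ \Gamma_{J_0}(\partial_x u)=0 & \text{on } J_0\end{cases}$$ has at most one solution $u\in W^2_{p,1}(\Pi;X)$: any two solutions in $W^2_{p,1}(\Pi;X)$ coincide a.e. in $\Pi$. -/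

import Mathlib

open MeasureTheory Set Filter Topology
open scoped ENNReal ContDiff

noncomputable section

namespace BochnerStrip

/-- The interval `I = (0, 2π)`. -/
def I : Set ℝ := Ioo 0 (2 * Real.pi)

/-- The open set `I × J`; `strip (Ioi 0)` is the half-strip `Π`, and `strip (Ioo 0 ξ)` is the
rectangle `Π_ξ`. -/
def strip (J : Set ℝ) : Set (ℝ × ℝ) := I ×ˢ J

/-- The classical partial derivative `∂_x^i ∂_y^j φ` of a scalar function of `(x, y)`. -/
def partialDeriv (i j : ℕ) (φ : ℝ × ℝ → ℝ) : ℝ × ℝ → ℝ :=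
  (fun ψ z => fderiv ℝ ψ z (1, 0))^[i] ((fun ψ z => fderiv ℝ ψ z (0, 1))^[j] φ)

variable {X : Type*} [NormedAddCommGroup X] [NormedSpace ℝ X]

/-- `w` is the weak derivative `∂_x^i ∂_y^j u` on the open set `Ω`: both functions are locally
(Bochner) integrable and the integration by parts formula holds against all `φ ∈ C_0^∞(Ω)`. -/
structure HasWeakDeriv (Ω : Set (ℝ × ℝ)) (i j : ℕ) (u w : ℝ × ℝ → X) : Prop where
  locallyIntegrable : LocallyIntegrableOn u Ω volume
  locallyIntegrable_deriv : LocallyIntegrableOn w Ω volume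
  integral_eq : ∀ φ : ℝ × ℝ → ℝ, ContDiff ℝ ∞ φ → HasCompactSupport φ → tsupport φ ⊆ Ω →
    ∫ z in Ω, partialDeriv i j φ z • u z = (-1 : ℝ) ^ (i + j) • ∫ z in Ω, φ z • w z

/-- The mixed norm `∫_J ‖w(·, y)‖_{L^p(I; X)} dy`, with values in `[0, ∞]`. -/
def mixedNorm (p : ℝ≥0∞) (J : Set ℝ) (w : ℝ × ℝ → X) : ℝ≥0∞ :=
  ∫⁻ y in J, eLpNorm (fun x => w (x, y)) p (volume.restrict I)

/-- Membership in the mixed-norm Bochner space `L^{p,1}(I × J; X)`. -/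
def MemMixedLp (p : ℝ≥0∞) (J : Set ℝ) (w : ℝ × ℝ → X) : Prop :=
  AEStronglyMeasurable w (volume.restrict (strip J)) ∧ mixedNorm p J w < ⊤

/-- Membership in the mixed-norm Bochner-Sobolev space `W^m_{p,1}(I × J; X)`: all weak derivatives
of order at most `m` exist and belong to `L^{p,1}(I × J; X)`. -/
def MemMixedSobolev (m : ℕ) (p : ℝ≥0∞) (J : Set ℝ) (u : ℝ × ℝ → X) : Prop :=
  ∀ i j : ℕ, i + j ≤ m → ∃ w, HasWeakDeriv (strip J) i j u w ∧ MemMixedLp p J w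

/-- The norm of `W^m_{p,1}(I × J; X)`: the sum of `‖∂^α u‖_{L^{p,1}}` over `|α| ≤ m`. A weak
derivative is determined almost everywhere and the mixed norm does not depend on the representative,
so the infimum is over a single value; it is `∞` if the weak derivative does not exist. -/
def mixedSobolevNorm (m : ℕ) (p : ℝ≥0∞) (J : Set ℝ) (u : ℝ × ℝ → X) : ℝ≥0∞ :=
  ∑ α ∈ (Finset.range (m + 1) ×ˢ Finset.range (m + 1)).filter (fun α => α.1 + α.2 ≤ m),
    ⨅ (w : ℝ × ℝ → X) (_ : HasWeakDeriv (strip J) α.1 α.2 u w), mixedNorm p J w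

/-- Membership in `W^m_{p,1}(Π_ξ; X) ∩ C(closure Π_ξ; X)`. -/
def MemSobolevContinuous (m : ℕ) (p : ℝ≥0∞) (ξ : ℝ) (v : ℝ × ℝ → X) : Prop :=
  MemMixedSobolev m p (Ioo 0 ξ) v ∧ ContinuousOn v (closure (strip (Ioo 0 ξ)))

/-- The graph of the trace operator of `W^1_{p,1}(Π; X)` on the half-line `{a} × (0, ∞)`, where `a`
is `0` or `2π`, with values in `L^1_loc`. For every `ξ > 0` it is, on `Π_ξ`, the continuous extension
from `W^1_{p,1}(Π_ξ; X)` to `L^1((0, ξ); X)` of the restriction `v ↦ v(a, ·)`, defined for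
`v ∈ W^1_{p,1}(Π_ξ; X) ∩ C(closure Π_ξ; X)`. -/
def HasLateralTrace (p : ℝ≥0∞) (a : ℝ) (u : ℝ × ℝ → X) (g : ℝ → X) : Prop :=
  MemMixedSobolev 1 p (Ioi 0) u ∧
  ∀ ξ : ℝ, 0 < ξ → IntegrableOn g (Ioo 0 ξ) volume ∧
    ∃ v : ℕ → ℝ × ℝ → X, (∀ n, MemSobolevContinuous 1 p ξ (v n)) ∧
      Tendsto (fun n => mixedSobolevNorm 1 p (Ioo 0 ξ) (v n - u)) atTop (𝓝 0) ∧
      Tendsto (fun n => eLpNorm (fun y => v n (a, y) - g y) 1 (volume.restrict (Ioo 0 ξ)))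
        atTop (𝓝 0)

/-- The graph of the trace operator of `W^1_{p,1}(Π; X)` on the base `I × {0}`, with values in
`L^p(I; X)`: the continuous extension of the restriction `v ↦ v(·, 0)`, defined for
`v ∈ W^1_{p,1}(Π_ξ; X) ∩ C(closure Π_ξ; X)`. -/
def HasBaseTrace (p : ℝ≥0∞) (u : ℝ × ℝ → X) (g : ℝ → X) : Prop :=
  MemMixedSobolev 1 p (Ioi 0) u ∧ MemLp g p (volume.restrict I) ∧
  ∀ ξ : ℝ, 0 < ξ →
    ∃ v : ℕ → ℝ × ℝ → X, (∀ n, MemSobolevContinuous 1 p ξ (v n)) ∧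
      Tendsto (fun n => mixedSobolevNorm 1 p (Ioo 0 ξ) (v n - u)) atTop (𝓝 0) ∧
      Tendsto (fun n => eLpNorm (fun x => v n (x, 0) - g x) p (volume.restrict I)) atTop (𝓝 0)

/-- `h` is the `k`-th weak derivative of `f` on the interval `I`. -/
structure HasWeakDerivInterval (k : ℕ) (f h : ℝ → X) : Prop where
  locallyIntegrable : LocallyIntegrableOn f I volume
  locallyIntegrable_deriv : LocallyIntegrableOn h I volume
  integral_eq : ∀ φ : ℝ → ℝ, ContDiff ℝ ∞ φ → HasCompactSupport φ → tsupport φ ⊆ I →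
    ∫ x in I, iteratedDeriv k φ x • f x = (-1 : ℝ) ^ k • ∫ x in I, φ x • h x

/-- Membership in the Bochner-Sobolev space `W^m_p(I; X)`. -/
def MemSobolevInterval (m : ℕ) (p : ℝ≥0∞) (f : ℝ → X) : Prop :=
  ∀ k : ℕ, k ≤ m → ∃ h, HasWeakDerivInterval k f h ∧ MemLp h p (volume.restrict I)

/-- `u ∈ W^2_{p,1}(Π; X)` solves the nonlocal boundary value problem with datum `f`: the Laplace
equation holds almost everywhere in `Π`, and the boundary conditions `u(x, 0) = f(x)`,
`u(0, y) = u(2π, y)`, `∂_x u(0, y) = 0` hold in the sense of traces. -/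
structure IsSolution (p : ℝ≥0∞) (f : ℝ → X) (u : ℝ × ℝ → X) : Prop where
  mem : MemMixedSobolev 2 p (Ioi 0) u
  laplace : ∃ uxx uyy : ℝ × ℝ → X,
    HasWeakDeriv (strip (Ioi 0)) 2 0 u uxx ∧ HasWeakDeriv (strip (Ioi 0)) 0 2 u uyy ∧
      ∀ᵐ z ∂(volume.restrict (strip (Ioi 0))), uxx z + uyy z = 0
  base : HasBaseTrace p u f
  periodic : ∃ g : ℝ → X, HasLateralTrace p 0 u g ∧ HasLateralTrace p (2 * Real.pi) u g
  flux : ∃ ux : ℝ × ℝ → X,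
    HasWeakDeriv (strip (Ioi 0)) 1 0 u ux ∧ HasLateralTrace p 0 ux (fun _ => 0)

end BochnerStrip

end

/-! Separation of variables against the adjoint system. Let `u` be the difference of two solutions
and let `θ` be smooth on `[0, 2π]` with `θ(2π) = 0` and `θ'(0) = θ'(2π)`. When `∫ θ u_xx dx` is
integrated by parts twice, every boundary term disappears: `u_x(0) = 0` and `θ(2π) = 0` remove those
with `u_x`, periodicity of `u` removes those with `u`. If `θ'' = -n²θ`, the coefficient `v(y) = ∫
θ(x) u(x, y) dx` therefore satisfies `v'' = n²v` weakly on the half-line, with `v`, `v'` integrable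
and `v(0) = 0`; integrability excludes `e^{ny}` and the initial condition excludes `e^{-ny}`, so `v
= 0` (`ae_eq_zero_of_isWeakDerivOn`).

The admissible eigenfunctions `sin nx` are not total. The missing functions are the root functions
`(2π - x) cos nx`, whose second derivative is `-n²` times themselves plus `2n sin nx`; the extra
term pairs to zero with `u` once the sine coefficients are known to vanish. The two families
together are total (`ae_eq_zero_of_forall_integral_eq_zero`), so almost every slice `u(·, y)` is
zero.

Boundary values exist only as limits of traces of continuous approximants. Each boundary condition
is therefore used through a Green formula, proved for functions continuous up to the boundary and
then passed to the limit (`HasLateralTrace.integral_eq`, `HasBaseTrace.integral_eq`). Since `I` is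
bounded, `L^{p,1}` embeds in `L^1`, where all these limits are taken. -/

namespace BochnerStrip

variable {X : Type*} [NormedAddCommGroup X] [NormedSpace ℝ X]

/-! ### Weak derivatives of vector-valued functions of one variable. -/

/-- `g` is the weak derivative of `f` on the set `s` of reals. -/
def IsWeakDerivOn (s : Set ℝ) (f g : ℝ → X) : Prop :=
  ∀ φ : ℝ → ℝ, ContDiff ℝ ∞ φ → HasCompactSupport φ → tsupport φ ⊆ s →
    ∫ x in s, deriv φ x • f x = -∫ x in s, φ x • g x

theorem setIntegral_smul_eq_integral {E : Type*} [TopologicalSpace E] [MeasurableSpace E]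
    (μ : Measure E)
    {s : Set E} {φ : E → ℝ} (h : tsupport φ ⊆ s) (f : E → X) :
    ∫ x in s, φ x • f x ∂μ = ∫ x, φ x • f x ∂μ := by
  refine setIntegral_eq_integral_of_forall_compl_eq_zero fun x hx => ?_
  rw [image_eq_zero_of_notMem_tsupport (fun h' => hx (h h')), zero_smul]

theorem integrableOn_smul_of_hasCompactSupport {E : Type*} [TopologicalSpace E]
    [MeasurableSpace E] [OpensMeasurableSpace E] {μ : Measure E} {s : Set E} {φ : E → ℝ}
    {f : E → X} (hf : IntegrableOn f s μ) (hφ : Continuous φ) (hc : HasCompactSupport φ) :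
    IntegrableOn (fun x => φ x • f x) s μ := by
  obtain ⟨C, hC⟩ := hc.exists_bound_of_continuous hφ
  exact Integrable.bdd_smul hf C hφ.aestronglyMeasurable (ae_of_all _ hC)

theorem integrableOn_smul_of_subset_isCompact {E : Type*} [TopologicalSpace E]
    [MeasurableSpace E] [OpensMeasurableSpace E] {μ : Measure E} {s K : Set E} {φ : E → ℝ}
    {f : E → X} (hf : IntegrableOn f s μ) (hs : MeasurableSet s) (hφ : Continuous φ)
    (hK : IsCompact K) (hsK : s ⊆ K) :
    IntegrableOn (fun x => φ x • f x) s μ := by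
  obtain ⟨C, hC⟩ := hK.exists_bound_of_continuousOn hφ.continuousOn
  exact Integrable.bdd_smul hf C hφ.aestronglyMeasurable
    (ae_restrict_of_forall_mem hs fun x hx => hC x (hsK hx))

/-- A smooth compactly supported function with integral zero is the derivative of another one. -/
theorem exists_deriv_eq_of_integral_eq_zero {s : Set ℝ} (hs : s.OrdConnected) {χ : ℝ → ℝ}
    (hχ : ContDiff ℝ ∞ χ) {K : Set ℝ} (hK : IsCompact K) (hKn : K.Nonempty) (hKs : K ⊆ s)
    (hsupp : tsupport χ ⊆ K) (h0 : ∫ x, χ x = 0) :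
    ∃ Φ : ℝ → ℝ, ContDiff ℝ ∞ Φ ∧ HasCompactSupport Φ ∧ tsupport Φ ⊆ s ∧ deriv Φ = χ := by
  have hzero : ∀ x, x ∉ K → χ x = 0 := fun x hx =>
    image_eq_zero_of_notMem_tsupport fun h => hx (hsupp h)
  have ha := hK.sInf_mem hKn
  have hb := hK.sSup_mem hKn
  have hIcc : ∀ x ∈ K, x ∈ Icc (sInf K) (sSup K) := fun x hx =>
    ⟨csInf_le hK.bddBelow hx, le_csSup hK.bddAbove hx⟩
  have hderiv : ∀ x, HasDerivAt (fun x => ∫ t in sInf K..x, χ t) (χ x) x := fun x =>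
    intervalIntegral.integral_hasDerivAt_right (hχ.continuous.intervalIntegrable _ _)
      hχ.continuous.stronglyMeasurable.stronglyMeasurableAtFilter hχ.continuous.continuousAt
  have hd : deriv (fun x => ∫ t in sInf K..x, χ t) = χ := funext fun x => (hderiv x).deriv
  have hts : tsupport (fun x => ∫ t in sInf K..x, χ t) ⊆ Icc (sInf K) (sSup K) := by
    refine closure_minimal (fun x hx => ?_) isClosed_Icc
    by_contra hxI
    apply hx
    beta_reduce
    rcases lt_or_ge x (sInf K) with h | h
    · rw [intervalIntegral.integral_symm, intervalIntegral.integral_of_le h.le,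
        integral_Ioc_eq_integral_Ioo, setIntegral_eq_zero_of_forall_eq_zero, neg_zero]
      exact fun y hy => hzero y fun hyK => (hIcc y hyK).1.not_gt hy.2
    · have hlt : sSup K < x := by
        by_contra h'
        exact hxI ⟨h, not_lt.1 h'⟩
      rw [intervalIntegral.integral_of_le h, ← integral_Icc_eq_integral_Ioc,
        setIntegral_eq_integral_of_forall_compl_eq_zero, h0]
      exact fun y hy => hzero y fun hyK => hy ⟨(hIcc y hyK).1, (hIcc y hyK).2.trans hlt.le⟩
  refine ⟨_, ?_, HasCompactSupport.of_support_subset_isCompact isCompact_Icc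
    ((subset_tsupport _).trans hts), hts.trans (hs.out (hKs ha) (hKs hb)), hd⟩
  rw [contDiff_infty_iff_deriv, hd]
  exact ⟨fun x => (hderiv x).differentiableAt, hχ⟩

/-- The du Bois-Reymond lemma. -/
theorem IsWeakDerivOn.ae_eq_const [CompleteSpace X] {s : Set ℝ} (hso : IsOpen s)
    (hs : s.OrdConnected) (hsn : s.Nonempty) {f : ℝ → X} (hf : LocallyIntegrableOn f s)
    (h : IsWeakDerivOn s f 0) : ∃ c : X, ∀ᵐ x ∂volume.restrict s, f x = c := by
  obtain ⟨x₀, hx₀⟩ := hsn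
  obtain ⟨r, hr, hrs⟩ := Metric.isOpen_iff.1 hso x₀ hx₀
  let b : ContDiffBump x₀ := ⟨r / 4, r / 2, by positivity, by linarith⟩
  have hbs : tsupport (b.normed volume) ⊆ s := by
    rw [b.tsupport_normed_eq]
    exact (Metric.closedBall_subset_ball (by change r / 2 < r; linarith)).trans hrs
  have hbc : HasCompactSupport (b.normed volume) := b.hasCompactSupport_normed
  have hbd : ContDiff ℝ ∞ (b.normed volume) := b.contDiff_normed
  have hint : ∀ φ : ℝ → ℝ, ContDiff ℝ ∞ φ → HasCompactSupport φ → tsupport φ ⊆ s →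
      Integrable (fun x => φ x • f x) := fun φ h1 h2 h3 => by
    have hK : IntegrableOn f (tsupport φ) := hf.integrableOn_compact_subset h3 h2
    have := integrableOn_smul_of_hasCompactSupport hK h1.continuous h2
    rwa [integrableOn_iff_integrable_of_support_subset] at this
    exact fun x hx => subset_tsupport φ fun h0 => hx (by simp [h0])
  refine ⟨∫ x in s, b.normed volume x • f x, ?_⟩
  set c := ∫ x in s, b.normed volume x • f x with hc
  rw [ae_restrict_iff' hso.measurableSet]
  have := hso.ae_eq_zero_of_integral_contDiff_smul_eq_zero (μ := volume)
    (f := fun x => f x - c) (hf.sub ((locallyIntegrable_const c).locallyIntegrableOn s)) ?_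
  · filter_upwards [this] with x hx hxs using sub_eq_zero.1 (hx hxs)
  intro φ hφ hφc hφs
  have hsub : tsupport (fun x => φ x - (∫ y, φ y) * b.normed volume x) ⊆
      tsupport φ ∪ tsupport (b.normed volume) := by
    refine closure_minimal (fun x hx => ?_) ((isClosed_tsupport _).union (isClosed_tsupport _))
    by_contra hx'
    rw [mem_union, not_or] at hx'
    apply hx
    simp [image_eq_zero_of_notMem_tsupport hx'.1, image_eq_zero_of_notMem_tsupport hx'.2]
  -- Subtracting `(∫ φ) b` from `φ` makes the integral zero, so the result is `Φ'` for an admissible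
  -- `Φ`. Testing with `Φ` gives `∫ φ f = (∫ φ) c`.
  obtain ⟨Φ, h1, h2, h3, h4⟩ := exists_deriv_eq_of_integral_eq_zero hs
    (χ := fun x => φ x - (∫ y, φ y) * b.normed volume x) (hφ.sub (contDiff_const.mul hbd))
    (hφc.isCompact.union hbc.isCompact)
    ⟨x₀, Or.inr (by rw [b.tsupport_normed_eq]; exact Metric.mem_closedBall_self (by positivity))⟩
    (union_subset hφs hbs) hsub (by
      rw [integral_sub (hφ.continuous.integrable_of_hasCompactSupport hφc)
        ((hbd.continuous.integrable_of_hasCompactSupport hbc).const_mul _),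
        integral_const_mul, b.integral_normed, mul_one, sub_self])
  have h5 := h Φ h1 h2 h3
  simp only [h4, Pi.zero_apply, smul_zero, integral_zero, neg_zero, sub_smul, mul_smul] at h5
  have hb' : IntegrableOn (fun x => (∫ y, φ y) • b.normed volume x • f x) s :=
    (hint _ hbd hbc hbs).integrableOn.smul (∫ y, φ y)
  rw [integral_sub (hint φ hφ hφc hφs).integrableOn hb', integral_smul, ← hc,
    setIntegral_smul_eq_integral _ hφs] at h5
  simp only [smul_sub]
  rw [integral_sub (hint φ hφ hφc hφs)
    ((hφ.continuous.integrable_of_hasCompactSupport hφc).smul_const c), integral_smul_const]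
  exact h5

theorem IsWeakDerivOn.primitive [CompleteSpace X] {a b : ℝ} {g : ℝ → X}
    (hg : IntegrableOn g (Ioo a b)) :
    IsWeakDerivOn (Ioo a b) (fun x => ∫ t in a..x, g t) g := by
  intro φ hφ hφc hφs
  have hφb : φ b = 0 := image_eq_zero_of_notMem_tsupport fun h => (hφs h).2.false
  have hd : Continuous (deriv φ) := hφ.continuous_deriv (by norm_num)
  obtain ⟨C, hC⟩ := hφc.deriv.exists_bound_of_continuous hd
  -- The Heaviside kernel turns the primitive into an integral over the whole interval, so that
  -- Fubini applies; the inner integral of `deriv φ` over `(t, b)` is then `-φ t`, as `φ b = 0`.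
  let k : ℝ → ℝ → ℝ := fun x t => if t ≤ x then 1 else 0
  have hint : Integrable (Function.uncurry fun x t => (deriv φ x * k x t) • g t)
      ((volume.restrict (Ioo a b)).prod (volume.restrict (Ioo a b))) := by
    refine Integrable.bdd_smul (C := C) (φ := fun z : ℝ × ℝ => deriv φ z.1 * k z.1 z.2)
      (f := fun z : ℝ × ℝ => g z.2) ?_ ?_ ?_
    · exact hg.comp_snd _
    · refine (((hd.comp continuous_fst).measurable).mul
        (Measurable.ite (measurableSet_le measurable_snd measurable_fst) measurable_const
          measurable_const)).aestronglyMeasurable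
    · refine ae_of_all _ fun z => ?_
      simp only [k]
      split_ifs
      · simpa using hC z.1
      · simpa using (norm_nonneg _).trans (hC z.1)
  have hswap := integral_integral_swap hint
  have h1 : ∀ x ∈ Ioo a b, ∫ t in Ioo a b, (deriv φ x * k x t) • g t =
      deriv φ x • ∫ t in a..x, g t := fun x hx => by
    simp only [mul_smul]
    rw [integral_smul, intervalIntegral.integral_of_le hx.1.le]
    congr 1
    have : (fun t => k x t • g t) = (Iic x).indicator g := by
      ext t
      by_cases ht : t ≤ x <;> simp [k, ht]
    rw [this, setIntegral_indicator measurableSet_Iic]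
    congr 2
    ext t
    simp only [mem_inter_iff, mem_Ioo, mem_Iic, mem_Ioc]
    exact ⟨fun h => ⟨h.1.1, h.2⟩, fun h => ⟨⟨h.1, h.2.trans_lt hx.2⟩, h.2⟩⟩
  have h2 : ∀ t ∈ Ioo a b, ∫ x in Ioo a b, (deriv φ x * k x t) • g t = -(φ t • g t) := by
    intro t ht
    rw [integral_smul_const, ← neg_smul]
    congr 1
    have : (fun x => deriv φ x * k x t) = (Ici t).indicator (deriv φ) := by
      ext x
      by_cases hx : t ≤ x <;> simp [k, hx]
    rw [this, setIntegral_indicator measurableSet_Ici]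
    have hset : Ioo a b ∩ Ici t = Ico t b := by
      ext x
      simp only [mem_inter_iff, mem_Ioo, mem_Ici, mem_Ico]
      exact ⟨fun h => ⟨h.2, h.1.2⟩, fun h => ⟨⟨ht.1.trans_le h.1, h.2⟩, h.1⟩⟩
    rw [hset, integral_Ico_eq_integral_Ioo, ← integral_Ioc_eq_integral_Ioo,
      ← intervalIntegral.integral_of_le ht.2.le, intervalIntegral.integral_deriv_eq_sub
        (fun x _ => (hφ.differentiable (by norm_num)).differentiableAt)
        (hd.intervalIntegrable _ _), hφb, zero_sub]
  rw [← setIntegral_congr_fun measurableSet_Ioo h1, hswap,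
    setIntegral_congr_fun measurableSet_Ioo h2, integral_neg]

theorem IsWeakDerivOn.sub {s : Set ℝ} {f f' g g' : ℝ → X} (h : IsWeakDerivOn s f g)
    (h' : IsWeakDerivOn s f' g') (hf : IntegrableOn f s) (hf' : IntegrableOn f' s)
    (hg : IntegrableOn g s) (hg' : IntegrableOn g' s) :
    IsWeakDerivOn s (f - f') (g - g') := by
  intro φ hφ hφc hφs
  have hd : Continuous (deriv φ) := hφ.continuous_deriv (by norm_num)
  simp only [Pi.sub_apply, smul_sub]
  rw [integral_sub (integrableOn_smul_of_hasCompactSupport hf hd hφc.deriv)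
    (integrableOn_smul_of_hasCompactSupport hf' hd hφc.deriv),
    integral_sub (integrableOn_smul_of_hasCompactSupport hg hφ.continuous hφc)
    (integrableOn_smul_of_hasCompactSupport hg' hφ.continuous hφc), h φ hφ hφc hφs,
    h' φ hφ hφc hφs]
  abel

/-- The fundamental theorem of calculus for a continuous function with integrable weak
derivative. -/
theorem IsWeakDerivOn.integral_eq_sub [CompleteSpace X] {a b : ℝ} (hab : a < b) {f g : ℝ → X}
    (hf : ContinuousOn f (Icc a b)) (hg : IntegrableOn g (Ioo a b))
    (h : IsWeakDerivOn (Ioo a b) f g) : ∫ x in Ioo a b, g x = f b - f a := by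
  have hgI : IntegrableOn g (Icc a b) := by rwa [integrableOn_Icc_iff_integrableOn_Ioo]
  have hprim : ContinuousOn (fun x => ∫ t in a..x, g t) (Icc a b) := by
    have := intervalIntegral.continuousOn_primitive_interval (μ := volume) (f := g) (a := a)
      (b := b) (by rwa [uIcc_of_le hab.le])
    rwa [uIcc_of_le hab.le] at this
  -- `f` minus the primitive of `g` has zero weak derivative, hence is constant almost everywhere,
  -- and by continuity everywhere on `[a, b]`, endpoints included.
  have hcont := hf.sub hprim
  obtain ⟨c, hc⟩ := IsWeakDerivOn.ae_eq_const isOpen_Ioo ordConnected_Ioo (nonempty_Ioo.2 hab)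
    ((hcont.integrableOn_Icc.mono_set Ioo_subset_Icc_self).locallyIntegrableOn)
    (by
      have := h.sub (IsWeakDerivOn.primitive hg)
        (hf.integrableOn_Icc.mono_set Ioo_subset_Icc_self)
        (hprim.integrableOn_Icc.mono_set Ioo_subset_Icc_self) hg hg
      rwa [sub_self] at this)
  rw [restrict_Ioo_eq_restrict_Icc] at hc
  have heq := Measure.eqOn_Icc_of_ae_eq volume hab.ne hc hcont continuousOn_const
  have ha := heq (left_mem_Icc.2 hab.le)
  have hb := heq (right_mem_Icc.2 hab.le)
  simp only [Pi.sub_apply, intervalIntegral.integral_same, sub_zero] at ha hb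
  rw [← integral_Ioc_eq_integral_Ioo, ← intervalIntegral.integral_of_le hab.le, ha]
  exact (sub_eq_of_eq_add' (sub_eq_iff_eq_add.1 hb)).symm

theorem IsWeakDerivOn.smul_Ioo {a b : ℝ} {f g : ℝ → X} {β : ℝ → ℝ}
    (hβ : ContDiff ℝ ∞ β) (hf : IntegrableOn f (Ioo a b)) (hg : IntegrableOn g (Ioo a b))
    (h : IsWeakDerivOn (Ioo a b) f g) :
    IsWeakDerivOn (Ioo a b) (fun x => β x • f x) (fun x => β x • g x + deriv β x • f x) := by
  intro φ hφ hφc hφs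
  have hd : Continuous (deriv φ) := hφ.continuous_deriv (by norm_num)
  have hdβ : Continuous (deriv β) := hβ.continuous_deriv (by norm_num)
  have hprod : ∀ x, deriv (fun x => φ x * β x) x = deriv φ x * β x + φ x * deriv β x := fun x =>
    deriv_fun_mul (hφ.differentiable (by norm_num)).differentiableAt
      (hβ.differentiable (by norm_num)).differentiableAt
  have h1 := h (fun x => φ x * β x) (hφ.mul hβ) hφc.mul_right
    ((tsupport_mul_subset_left).trans hφs)
  simp only [hprod, add_smul, mul_smul] at h1
  have hint : ∀ (γ : ℝ → ℝ) (k : ℝ → X), Continuous γ → IntegrableOn k (Ioo a b) →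
      IntegrableOn (fun x => γ x • k x) (Ioo a b) := fun γ k hγ hk =>
    integrableOn_smul_of_subset_isCompact hk measurableSet_Ioo hγ isCompact_Icc
      Ioo_subset_Icc_self
  rw [integral_add (hint _ _ hd (hint _ _ hβ.continuous hf))
    (hint _ _ hφ.continuous (hint _ _ hdβ hf))] at h1
  simp only [smul_add]
  rw [integral_add (hint _ _ hφ.continuous (hint _ _ hβ.continuous hg))
    (hint _ _ hφ.continuous (hint _ _ hdβ hf)), eq_sub_of_add_eq h1]
  abel

theorem IsWeakDerivOn.integral_smul_add_deriv_smul [CompleteSpace X] {a b : ℝ} (hab : a < b)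
    {f g : ℝ → X} {β : ℝ → ℝ} (hβ : ContDiff ℝ ∞ β) (hf : ContinuousOn f (Icc a b))
    (hg : IntegrableOn g (Ioo a b)) (h : IsWeakDerivOn (Ioo a b) f g) :
    ∫ x in Ioo a b, (β x • g x + deriv β x • f x) = β b • f b - β a • f a := by
  have hfi := hf.integrableOn_Icc (μ := volume) |>.mono_set Ioo_subset_Icc_self
  refine (h.smul_Ioo hβ hfi hg).integral_eq_sub hab (hβ.continuous.continuousOn.smul hf) ?_
  exact (integrableOn_smul_of_subset_isCompact hg measurableSet_Ioo hβ.continuous isCompact_Icc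
      Ioo_subset_Icc_self).add (integrableOn_smul_of_subset_isCompact hfi measurableSet_Ioo
      (hβ.continuous_deriv (by norm_num)) isCompact_Icc Ioo_subset_Icc_self)

/-! ### Weak ordinary differential equations on the half-line. -/

/-- The integrating factor works weakly: testing the equation with `φ(y) e^{-μy}` shows that
`e^{-μy} z` has zero weak derivative. -/
theorem IsWeakDerivOn.eq_exp_smul [CompleteSpace X] {s : Set ℝ} (hso : IsOpen s)
    (hs : s.OrdConnected) (hsn : s.Nonempty) {z : ℝ → X} {μ : ℝ} (hz : IntegrableOn z s)
    (h : IsWeakDerivOn s z (μ • z)) :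
    ∃ A : X, ∀ᵐ y ∂volume.restrict s, z y = Real.exp (μ * y) • A := by
  have hexp : ContDiff ℝ ∞ fun y : ℝ => Real.exp (-(μ * y)) := by fun_prop
  obtain ⟨A, hA⟩ := IsWeakDerivOn.ae_eq_const (f := fun y => Real.exp (-(μ * y)) • z y) hso hs hsn
    ((hz.locallyIntegrableOn).continuousOn_smul hso.isLocallyClosed hexp.continuous.continuousOn)
    (by
      intro φ hφ hφc hφs
      have hd : Continuous (deriv φ) := hφ.continuous_deriv (by norm_num)
      have h1 := h (fun y => φ y * Real.exp (-(μ * y))) (hφ.mul hexp) hφc.mul_right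
        (tsupport_mul_subset_left.trans hφs)
      have hprod : ∀ y, deriv (fun y => φ y * Real.exp (-(μ * y))) y =
          deriv φ y * Real.exp (-(μ * y)) - μ * (φ y * Real.exp (-(μ * y))) := fun y => by
        have h2 : HasDerivAt (fun y => Real.exp (-(μ * y))) (Real.exp (-(μ * y)) * -(μ * 1)) y :=
          (((hasDerivAt_id y).const_mul μ).neg).exp
        rw [((hφ.differentiable (by norm_num) y).hasDerivAt.fun_mul h2).deriv]
        ring
      simp only [hprod, sub_smul, Pi.smul_apply] at h1
      rw [integral_sub (integrableOn_smul_of_hasCompactSupport hz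
        (φ := fun y => deriv φ y * Real.exp (-(μ * y))) (hd.mul hexp.continuous)
        hφc.deriv.mul_right) (integrableOn_smul_of_hasCompactSupport hz
          (φ := fun y => μ * (φ y * Real.exp (-(μ * y))))
          (continuous_const.mul (hφ.continuous.mul hexp.continuous)) hφc.mul_right.mul_left)] at h1
      simp only [Pi.zero_apply, smul_zero, integral_zero, neg_zero]
      simp only [smul_smul] at h1 ⊢
      rw [sub_eq_iff_eq_add] at h1
      rw [h1, neg_add_eq_zero]
      simp only [mul_comm μ])
  refine ⟨A, hA.mono fun y hy => ?_⟩
  rw [← hy, smul_smul, ← Real.exp_add, add_neg_cancel, Real.exp_zero, one_smul]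

/-- An integrable weak solution of `v'' = k² v` on the half-line with `v(0) = 0` vanishes. The
condition at `0` is expressed by integration by parts on `(0, 1)`. -/
theorem ae_eq_zero_of_isWeakDerivOn [CompleteSpace X] {v v' : ℝ → X} {k : ℝ} (hk : 0 ≤ k)
    (hv : IntegrableOn v (Ioi 0)) (hv' : IntegrableOn v' (Ioi 0))
    (h1 : IsWeakDerivOn (Ioi 0) v v') (h2 : IsWeakDerivOn (Ioi 0) v' (k ^ 2 • v))
    (h0 : ∀ β : ℝ → ℝ, ContDiff ℝ ∞ β → β 1 = 0 →
      ∫ y in Ioo 0 1, (β y • v' y + deriv β y • v y) = 0) :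
    ∀ᵐ y ∂volume.restrict (Ioi 0), v y = 0 := by
  have hsub : ∀ {c : ℝ}, IntegrableOn (c • v) (Ioi 0) := fun {c} => hv.smul c
  have h1' : ∀ c : ℝ, IsWeakDerivOn (Ioi 0) (c • v) (c • v') := fun c φ hφ hc hs => by
    simp only [Pi.smul_apply, smul_comm _ c]
    rw [integral_smul, integral_smul, h1 φ hφ hc hs, smul_neg]
  -- Factorization of `∂² - k²` as `(∂ - k)(∂ + k)`: the function `v' + kv` solves a first-order
  -- equation.
  have hz : IsWeakDerivOn (Ioi 0) (v' - (-k) • v) (k • (v' - (-k) • v)) := by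
    have := h2.sub (h1' (-k)) hv' hsub hsub (hv'.smul (-k))
    convert this using 1
    module
  obtain ⟨A, hA⟩ := hz.eq_exp_smul isOpen_Ioi ordConnected_Ioi ⟨1, mem_Ioi.2 one_pos⟩
    (hv'.sub hsub)
  -- Since `k ≥ 0`, `‖A‖ ≤ ‖e^{ky} A‖` on the half-line, so the constant `A` would be integrable
  -- over a set of infinite measure.
  have hA0 : A = 0 := by
    have hc : IntegrableOn (fun _ : ℝ => A) (Ioi 0) := by
      refine Integrable.mono (hv'.sub (hsub (c := -k))) aestronglyMeasurable_const ?_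
      filter_upwards [hA, ae_restrict_mem measurableSet_Ioi] with y hy hy0
      rw [hy, norm_smul, Real.norm_eq_abs, Real.abs_exp]
      exact le_mul_of_one_le_left (norm_nonneg _)
        (Real.one_le_exp (mul_nonneg hk (le_of_lt hy0)))
    rw [integrableOn_const_iff] at hc
    simpa using hc
  have hv'eq : ∀ᵐ y ∂volume.restrict (Ioi 0), v' y = (-k) • v y := by
    filter_upwards [hA] with y hy
    rw [hA0, smul_zero] at hy
    exact sub_eq_zero.1 hy
  obtain ⟨B, hB⟩ := IsWeakDerivOn.eq_exp_smul (z := v) (μ := -k) isOpen_Ioi ordConnected_Ioi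
    ⟨1, mem_Ioi.2 one_pos⟩ hv (by
      intro φ hφ hc hs
      rw [h1 φ hφ hc hs]
      congr 1
      refine integral_congr_ae ?_
      filter_upwards [hv'eq] with y hy
      rw [hy, Pi.smul_apply])
  have hB0 : B = 0 := by
    -- This `β` vanishes at `1`, and with `v = e^{-ky} B`, `v' = -kv` the integrand `β v' + β' v`
    -- reduces to the constant `-B`.
    have h3 := h0 (fun y => (1 - y) * Real.exp (k * y)) (by fun_prop) (by simp)
    have hd : ∀ y, deriv (fun y : ℝ => (1 - y) * Real.exp (k * y)) y =
        -Real.exp (k * y) + (1 - y) * (Real.exp (k * y) * k) := fun y => by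
      have h4 : HasDerivAt (fun y : ℝ => 1 - y) (-1) y := by
        simpa using (hasDerivAt_id y).const_sub 1
      have h5 : HasDerivAt (fun y => Real.exp (k * y)) (Real.exp (k * y) * (k * 1)) y :=
        ((hasDerivAt_id y).const_mul k).exp
      rw [(h4.fun_mul h5).deriv]
      ring
    have h6 : ∫ y in Ioo (0 : ℝ) 1, (((1 - y) * Real.exp (k * y)) • v' y +
        deriv (fun y : ℝ => (1 - y) * Real.exp (k * y)) y • v y) =
        ∫ y in Ioo (0 : ℝ) 1, -B := by
      refine integral_congr_ae ?_
      have hle : volume.restrict (Ioo (0 : ℝ) 1) ≤ volume.restrict (Ioi 0) :=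
        Measure.restrict_mono_set _ Ioo_subset_Ioi_self
      filter_upwards [ae_mono hle hv'eq, ae_mono hle hB] with y hy1 hy2
      rw [hy1, hd, smul_smul, ← add_smul, hy2, smul_smul]
      have : Real.exp (k * y) * Real.exp (-k * y) = 1 := by
        rw [← Real.exp_add, neg_mul, add_neg_cancel, Real.exp_zero]
      rw [show ((1 - y) * Real.exp (k * y) * -k + (-Real.exp (k * y) +
        (1 - y) * (Real.exp (k * y) * k))) * Real.exp (-k * y) =
        -(Real.exp (k * y) * Real.exp (-k * y)) by ring, this, neg_smul, one_smul]
    rw [h6] at h3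
    simpa using h3
  filter_upwards [hB] with y hy
  rw [hy, hB0, smul_zero]

/-! ### Totality of the adjoint system on `(0, 2π)`. -/

/-- Weierstrass: `K` is a uniform limit of polynomials on `[-1, 1]`, the range of the cosine. -/
theorem integral_comp_cos_smul_eq_zero {W : ℝ → X} (hW : IntegrableOn W I)
    (h : ∀ m : ℕ, ∫ x in I, Real.cos x ^ m • W x = 0) {K : ℝ → ℝ} (hK : Continuous K) :
    ∫ x in I, K (Real.cos x) • W x = 0 := by
  have hint : ∀ {g : ℝ → ℝ}, Continuous g → IntegrableOn (fun x => g (Real.cos x) • W x) I :=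
    fun {g} hg => integrableOn_smul_of_subset_isCompact hW measurableSet_Ioo
      (hg.comp Real.continuous_cos) isCompact_Icc Ioo_subset_Icc_self
  have hpoly : ∀ P : Polynomial ℝ, ∫ x in I, P.eval (Real.cos x) • W x = 0 := fun P => by
    simp only [Polynomial.eval_eq_sum_range, Finset.sum_smul, mul_smul]
    rw [integral_finsetSum]
    · refine Finset.sum_eq_zero fun m _ => ?_
      rw [integral_smul, h, smul_zero]
    · exact fun m _ => (hint (g := fun t => t ^ m) (by fun_prop)).smul (P.coeff m)
  rw [← norm_le_zero_iff]
  refine le_of_forall_pos_le_add fun ε hε => ?_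
  rw [zero_add]
  set M := ∫ x in I, ‖W x‖ with hM
  have hM0 : 0 ≤ M := integral_nonneg fun x => norm_nonneg _
  obtain ⟨P, hP⟩ := exists_polynomial_near_of_continuousOn (-1) 1 K hK.continuousOn
    (ε / (M + 1)) (by positivity)
  rw [← sub_zero (∫ x in I, K (Real.cos x) • W x), ← hpoly P,
    ← integral_sub (hint hK) (hint P.continuous)]
  calc ‖∫ x in I, (K (Real.cos x) • W x - P.eval (Real.cos x) • W x)‖
      ≤ ∫ x in I, ε / (M + 1) * ‖W x‖ := by
        refine norm_integral_le_of_norm_le (hW.norm.const_mul _) (ae_of_all _ fun x => ?_)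
        rw [← sub_smul, norm_smul, Real.norm_eq_abs, abs_sub_comm]
        exact mul_le_mul_of_nonneg_right (hP _ (Real.cos_mem_Icc x)).le (norm_nonneg _)
    _ = ε / (M + 1) * M := by rw [integral_const_mul]
    _ ≤ ε := by
        rw [div_mul_eq_mul_div, div_le_iff₀ (by positivity)]
        nlinarith

/-- The cosine identifies exactly `x` and `2π - x`, so functions of `cos x` see only the sum of `W`
and its reflection. A test function `φ` on `(0, π)` is such a function, through `K = φ ∘ arccos`. -/
theorem ae_add_reflect_eq_zero [CompleteSpace X] {W : ℝ → X} (hW : IntegrableOn W I)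
    (h : ∀ m : ℕ, ∫ x in I, Real.cos x ^ m • W x = 0) :
    ∀ᵐ x, x ∈ Ioo 0 Real.pi → W x + W (2 * Real.pi - x) = 0 := by
  have hpi := Real.pi_pos
  have hWi : ∀ {a b}, a ∈ Icc 0 (2 * Real.pi) → b ∈ Icc 0 (2 * Real.pi) →
      IntervalIntegrable W volume a b := fun {a b} ha hb => by
    have : IntervalIntegrable W volume 0 (2 * Real.pi) :=
      (intervalIntegrable_iff_integrableOn_Ioo_of_le (by positivity)).2 hW
    refine this.mono_set ?_
    rw [uIcc_of_le (a := 0) (b := 2 * Real.pi) (by positivity)]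
    exact uIcc_subset_Icc ha hb
  have hm0 : (0 : ℝ) ∈ Icc 0 (2 * Real.pi) := ⟨le_rfl, by positivity⟩
  have hm1 : Real.pi ∈ Icc 0 (2 * Real.pi) := ⟨by positivity, by linarith⟩
  have hm2 : 2 * Real.pi ∈ Icc 0 (2 * Real.pi) := ⟨by positivity, le_rfl⟩
  have hrefl : IntervalIntegrable (fun x => W (2 * Real.pi - x)) volume 0 Real.pi := by
    have := (hWi hm2 hm1).comp_sub_left (2 * Real.pi)
    rwa [sub_self, two_mul, add_sub_cancel_right, ← two_mul] at this
  have hsum : IntervalIntegrable (fun x => W x + W (2 * Real.pi - x)) volume 0 Real.pi :=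
    (hWi hm0 hm1).add hrefl
  refine isOpen_Ioo.ae_eq_zero_of_integral_contDiff_smul_eq_zero
    ((intervalIntegrable_iff_integrableOn_Ioo_of_le hpi.le).1 hsum).locallyIntegrableOn ?_
  intro φ hφ hφc hφs
  have hK : Continuous fun t => φ (Real.arccos t) := hφ.continuous.comp Real.continuous_arccos
  have h1 := integral_comp_cos_smul_eq_zero hW h hK
  have hKc : Continuous fun x => φ (Real.arccos (Real.cos x)) := hK.comp Real.continuous_cos
  rw [I, ← integral_Ioc_eq_integral_Ioo, ← intervalIntegral.integral_of_le (by positivity),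
    ← intervalIntegral.integral_add_adjacent_intervals (b := Real.pi)
      ((hWi hm0 hm1).continuousOn_smul hKc.continuousOn)
      ((hWi hm1 hm2).continuousOn_smul hKc.continuousOn)] at h1
  have h2 := intervalIntegral.integral_comp_sub_left (a := 0) (b := Real.pi)
    (fun x => φ (Real.arccos (Real.cos x)) • W x) (2 * Real.pi)
  rw [sub_zero, show 2 * Real.pi - Real.pi = Real.pi by ring] at h2
  have hcos : ∀ x, Real.cos (2 * Real.pi - x) = Real.cos x := Real.cos_two_pi_sub
  simp only [hcos] at h2
  rw [← h2, ← intervalIntegral.integral_add ((hWi hm0 hm1).continuousOn_smul hKc.continuousOn)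
    (hrefl.continuousOn_smul hKc.continuousOn), intervalIntegral.integral_of_le hpi.le,
    integral_Ioc_eq_integral_Ioo] at h1
  rw [← setIntegral_smul_eq_integral _ hφs, ← h1]
  refine setIntegral_congr_fun measurableSet_Ioo fun x hx => ?_
  rw [Real.arccos_cos hx.1.le hx.2.le, smul_add]

/-- Induction on `m`, for all `n` at once, by `2 cos x sin (n+1)x = sin (n+2)x + sin nx`. It
produces the moments in `cos x` needed for the reflection argument. -/
theorem integral_cos_pow_mul_sin_smul_eq_zero {U : ℝ → X} (hU : IntegrableOn U I)
    (h : ∀ n : ℕ, ∫ x in I, Real.sin (n * x) • U x = 0) (m : ℕ) :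
    ∀ n : ℕ, ∫ x in I, (Real.cos x ^ m * Real.sin (n * x)) • U x = 0 := by
  induction m with
  | zero => simpa using h
  | succ m ih =>
    intro n
    rcases n with _ | n
    · simp
    have hint : ∀ n : ℕ, IntegrableOn (fun x => (Real.cos x ^ m * Real.sin (n * x)) • U x) I :=
      fun n => integrableOn_smul_of_subset_isCompact hU measurableSet_Ioo (by fun_prop)
        isCompact_Icc Ioo_subset_Icc_self
    have heq : ∀ x : ℝ, (Real.cos x ^ (m + 1) * Real.sin ((n + 1 : ℕ) * x)) • U x =
        (2⁻¹ : ℝ) • ((Real.cos x ^ m * Real.sin ((n + 2 : ℕ) * x)) • U x +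
          (Real.cos x ^ m * Real.sin (n * x)) • U x) := fun x => by
      rw [← add_smul, smul_smul]
      congr 1
      have h1 := Real.sin_add ((n + 1 : ℕ) * x) x
      have h2 := Real.sin_sub ((n + 1 : ℕ) * x) x
      rw [show ((n + 1 : ℕ) : ℝ) * x + x = (n + 2 : ℕ) * x by push_cast; ring] at h1
      rw [show ((n + 1 : ℕ) : ℝ) * x - x = n * x by push_cast; ring] at h2
      rw [h1, h2]
      ring
    simp only [heq]
    rw [integral_smul, integral_add (hint _) (hint _), ih, ih, add_zero, smul_zero]

theorem integral_cos_pow_mul_cos_smul_eq_zero {U : ℝ → X} (hU : IntegrableOn U I)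
    (h : ∀ n : ℕ, ∫ x in I, Real.cos (n * x) • U x = 0) (m : ℕ) :
    ∀ n : ℕ, ∫ x in I, (Real.cos x ^ m * Real.cos (n * x)) • U x = 0 := by
  induction m with
  | zero => simpa using h
  | succ m ih =>
    intro n
    rcases n with _ | n
    -- For `n = 0` there is no index below; the additional factor `cos x` is itself the cosine of
    -- frequency `1`.
    · simpa [pow_succ] using ih 1
    have hint : ∀ n : ℕ, IntegrableOn (fun x => (Real.cos x ^ m * Real.cos (n * x)) • U x) I :=
      fun n => integrableOn_smul_of_subset_isCompact hU measurableSet_Ioo (by fun_prop)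
        isCompact_Icc Ioo_subset_Icc_self
    have heq : ∀ x : ℝ, (Real.cos x ^ (m + 1) * Real.cos ((n + 1 : ℕ) * x)) • U x =
        (2⁻¹ : ℝ) • ((Real.cos x ^ m * Real.cos ((n + 2 : ℕ) * x)) • U x +
          (Real.cos x ^ m * Real.cos (n * x)) • U x) := fun x => by
      rw [← add_smul, smul_smul]
      congr 1
      have h1 := Real.cos_add ((n + 1 : ℕ) * x) x
      have h2 := Real.cos_sub ((n + 1 : ℕ) * x) x
      rw [show ((n + 1 : ℕ) : ℝ) * x + x = (n + 2 : ℕ) * x by push_cast; ring] at h1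
      rw [show ((n + 1 : ℕ) : ℝ) * x - x = n * x by push_cast; ring] at h2
      rw [h1, h2]
      ring
    simp only [heq]
    rw [integral_smul, integral_add (hint _) (hint _), ih, ih, add_zero, smul_zero]

/-- The functions `sin nx`, `(2π - x) cos nx` are total on the interval `(0, 2π)`. -/
theorem ae_eq_zero_of_forall_integral_eq_zero [CompleteSpace X] {U : ℝ → X}
    (hU : IntegrableOn U I) (hsin : ∀ n : ℕ, ∫ x in I, Real.sin (n * x) • U x = 0)
    (hcos : ∀ n : ℕ, ∫ x in I, ((2 * Real.pi - x) * Real.cos (n * x)) • U x = 0) :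
    ∀ᵐ x ∂volume.restrict I, U x = 0 := by
  have hS : IntegrableOn (fun x => Real.sin x • U x) I :=
    integrableOn_smul_of_subset_isCompact hU measurableSet_Ioo (by fun_prop)
      isCompact_Icc Ioo_subset_Icc_self
  have hC : IntegrableOn (fun x => (2 * Real.pi - x) • U x) I :=
    integrableOn_smul_of_subset_isCompact hU measurableSet_Ioo (by fun_prop)
      isCompact_Icc Ioo_subset_Icc_self
  have h1 := ae_add_reflect_eq_zero hS fun m => by
    simpa [smul_smul] using integral_cos_pow_mul_sin_smul_eq_zero hU hsin m 1
  have h2 := ae_add_reflect_eq_zero hC fun m => by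
    simpa using integral_cos_pow_mul_cos_smul_eq_zero hC
      (by simpa [smul_smul, mul_comm] using hcos) m 0
  have h3 : ∀ᵐ x, x ∈ Ioo 0 Real.pi → U x = 0 ∧ U (2 * Real.pi - x) = 0 := by
    filter_upwards [h1, h2] with x hx1 hx2 hx
    -- As the sine is odd about `π`, `e1` gives `U(x) = U(2π - x)`. Then `e2`, which is `(2π - x)
    -- U(x) + x U(2π - x) = 0`, becomes `2π U(x) = 0`.
    have e1 := hx1 hx
    have e2 := hx2 hx
    rw [Real.sin_two_pi_sub, neg_smul, ← sub_eq_add_neg, ← smul_sub, smul_eq_zero,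
      or_iff_right (Real.sin_pos_of_pos_of_lt_pi hx.1 hx.2).ne', sub_eq_zero] at e1
    rw [sub_sub_cancel, ← e1, ← add_smul, sub_add_cancel, smul_eq_zero,
      or_iff_right Real.two_pi_pos.ne'] at e2
    exact ⟨e2, e1 ▸ e2⟩
  have h4 := (Measure.measurePreserving_sub_left volume (2 * Real.pi)).quasiMeasurePreserving.ae h3
  rw [I, ae_restrict_iff' measurableSet_Ioo]
  have h5 : ∀ᵐ x : ℝ, x ≠ Real.pi := by simp [ae_iff, measure_singleton]
  filter_upwards [h3, h4, h5] with x hx3 hx4 hx5 hx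
  rcases lt_or_gt_of_ne hx5 with hlt | hlt
  · exact (hx3 ⟨hx.1, hlt⟩).1
  · have := (hx4 ⟨by linarith [hx.2], by linarith⟩).2
    rwa [sub_sub_cancel] at this

/-! ### Mixed-norm spaces on the strip and their embedding in `L^1`. -/

theorem isOpen_strip {J : Set ℝ} (hJ : IsOpen J) : IsOpen (strip J) := isOpen_Ioo.prod hJ

theorem HasWeakDeriv.ae_eq [CompleteSpace X] {Ω : Set (ℝ × ℝ)} (hΩ : IsOpen Ω) {i j : ℕ}
    {u w w' : ℝ × ℝ → X} (h : HasWeakDeriv Ω i j u w) (h' : HasWeakDeriv Ω i j u w') :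
    w =ᵐ[volume.restrict Ω] w' := by
  have hint : ∀ {w : ℝ × ℝ → X}, LocallyIntegrableOn w Ω → ∀ φ : ℝ × ℝ → ℝ, ContDiff ℝ ∞ φ →
      HasCompactSupport φ → tsupport φ ⊆ Ω → Integrable (fun x => φ x • w x) :=
    fun {w} hw φ h1 h2 h3 => by
    have := integrableOn_smul_of_hasCompactSupport
      (hw.integrableOn_compact_subset h3 h2) h1.continuous h2
    rwa [integrableOn_iff_integrable_of_support_subset] at this
    exact fun x hx => subset_tsupport φ fun h0 => hx (by simp [h0])
  have := hΩ.ae_eq_zero_of_integral_contDiff_smul_eq_zero (μ := volume)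
    (f := fun x => w x - w' x) (h.locallyIntegrable_deriv.sub h'.locallyIntegrable_deriv) ?_
  · rw [EventuallyEq, ae_restrict_iff' hΩ.measurableSet]
    filter_upwards [this] with x hx hxs using sub_eq_zero.1 (hx hxs)
  intro φ hφ hφc hφs
  simp only [smul_sub]
  rw [integral_sub (hint h.locallyIntegrable_deriv φ hφ hφc hφs)
    (hint h'.locallyIntegrable_deriv φ hφ hφc hφs), sub_eq_zero,
    ← setIntegral_smul_eq_integral volume hφs w, ← setIntegral_smul_eq_integral volume hφs w']
  have := (h.integral_eq φ hφ hφc hφs).symm.trans (h'.integral_eq φ hφ hφc hφs)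
  exact smul_right_injective X (pow_ne_zero (i + j) (by norm_num : (-1 : ℝ) ≠ 0)) this

theorem HasWeakDeriv.refl {Ω : Set (ℝ × ℝ)} {u : ℝ × ℝ → X} (h : LocallyIntegrableOn u Ω) :
    HasWeakDeriv Ω 0 0 u u :=
  ⟨h, h, fun φ _ _ _ => by simp [partialDeriv]⟩

/-- The norm of the embedding of `L^p(I)` into `L^1(I)`. -/
noncomputable def embeddingConst (p : ℝ≥0∞) : ℝ≥0∞ :=
  (volume.restrict I) univ ^ (1 / (1 : ℝ≥0∞).toReal - 1 / p.toReal)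

theorem volume_restrict_I_univ : (volume.restrict I) univ = ENNReal.ofReal (2 * Real.pi) := by
  simp [I]

theorem embeddingConst_ne_zero (p : ℝ≥0∞) : embeddingConst p ≠ 0 := by
  rw [embeddingConst, volume_restrict_I_univ]
  exact (ENNReal.rpow_pos (by simpa using Real.pi_pos) ENNReal.ofReal_ne_top).ne'

theorem embeddingConst_ne_top (p : ℝ≥0∞) : embeddingConst p ≠ ⊤ := by
  rw [embeddingConst, volume_restrict_I_univ]
  exact ENNReal.rpow_ne_top_of_ne_zero (by simpa using Real.pi_pos) ENNReal.ofReal_ne_top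

theorem lintegral_enorm_le_eLpNorm {E : Type*} [NormedAddCommGroup E] {p : ℝ≥0∞}
    (hp : 1 ≤ p) {f : ℝ → E}
    (hf : AEStronglyMeasurable f (volume.restrict I)) :
    ∫⁻ x in I, ‖f x‖ₑ ≤ eLpNorm f p (volume.restrict I) * embeddingConst p := by
  rw [← eLpNorm_one_eq_lintegral_enorm]
  exact eLpNorm_le_eLpNorm_mul_rpow_measure_univ hp hf

/-- Hölder in `x` on the bounded interval `I`, then Tonelli in `y`. -/
theorem lintegral_enorm_le_mixedNorm {E : Type*} [NormedAddCommGroup E] {p : ℝ≥0∞}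
    (hp : 1 ≤ p) {J : Set ℝ} {w : ℝ × ℝ → E}
    (hw : AEStronglyMeasurable w (volume.restrict (strip J))) :
    ∫⁻ z in strip J, ‖w z‖ₑ ≤ mixedNorm p J w * embeddingConst p := by
  rw [strip, Measure.volume_eq_prod, ← Measure.prod_restrict] at hw ⊢
  rw [lintegral_prod_symm _ hw.enorm, mixedNorm,
    ← lintegral_mul_const' _ _ (embeddingConst_ne_top p)]
  refine lintegral_mono_ae ?_
  filter_upwards [hw.prod_swap.prodMk_left] with y hy
  exact lintegral_enorm_le_eLpNorm hp hy

theorem MemMixedLp.integrableOn {E : Type*} [NormedAddCommGroup E] {p : ℝ≥0∞}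
    (hp : 1 ≤ p) {J : Set ℝ} {w : ℝ × ℝ → E}
    (hw : MemMixedLp p J w) : IntegrableOn w (strip J) :=
  ⟨hw.1, (lintegral_enorm_le_mixedNorm hp hw.1).trans_lt
    (ENNReal.mul_lt_top hw.2 (embeddingConst_ne_top p).lt_top)⟩

theorem MemMixedSobolev.integrableOn [CompleteSpace X] {m : ℕ} {p : ℝ≥0∞} (hp : 1 ≤ p)
    {J : Set ℝ} (hJ : IsOpen J)
    {u w : ℝ × ℝ → X} (hu : MemMixedSobolev m p J u) {i j : ℕ} (hij : i + j ≤ m)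
    (hw : HasWeakDeriv (strip J) i j u w) : IntegrableOn w (strip J) := by
  obtain ⟨w', h1, h2⟩ := hu i j hij
  exact (h2.integrableOn hp).congr (h1.ae_eq (isOpen_strip hJ) hw)

theorem MemMixedSobolev.integrableOn_self [CompleteSpace X] {m : ℕ} {p : ℝ≥0∞} (hp : 1 ≤ p)
    {J : Set ℝ} (hJ : IsOpen J) {u : ℝ × ℝ → X} (hu : MemMixedSobolev m p J u) :
    IntegrableOn u (strip J) :=
  hu.integrableOn hp hJ (i := 0) (j := 0) (Nat.zero_le _)
    (HasWeakDeriv.refl (hu 0 0 (Nat.zero_le _)).choose_spec.1.locallyIntegrable)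

theorem exists_hasWeakDeriv_mixedNorm_lt {m : ℕ} {p : ℝ≥0∞} {J : Set ℝ} {u : ℝ × ℝ → X}
    {δ : ℝ≥0∞} (h : mixedSobolevNorm m p J u < δ) {i j : ℕ} (hij : i + j ≤ m) :
    ∃ w, HasWeakDeriv (strip J) i j u w ∧ mixedNorm p J w < δ := by
  have hle : (⨅ (w : ℝ × ℝ → X) (_ : HasWeakDeriv (strip J) i j u w), mixedNorm p J w) ≤
      mixedSobolevNorm m p J u :=
    Finset.single_le_sum (f := fun α : ℕ × ℕ => ⨅ (w : ℝ × ℝ → X)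
      (_ : HasWeakDeriv (strip J) α.1 α.2 u w), mixedNorm p J w) (fun _ _ => zero_le)
      (a := (i, j)) (by simp; omega)
  simpa only [iInf_lt_iff, exists_prop] using hle.trans_lt h

/-! ### Test functions of product form. -/

theorem partialDeriv_mul {φ ψ : ℝ → ℝ} (hφ : ContDiff ℝ ∞ φ) (hψ : ContDiff ℝ ∞ ψ) (i j : ℕ) :
    partialDeriv i j (fun z => φ z.1 * ψ z.2) = fun z => deriv^[i] φ z.1 * deriv^[j] ψ z.2 := by
  have hfst : ∀ {φ ψ : ℝ → ℝ}, ContDiff ℝ ∞ φ → ContDiff ℝ ∞ ψ → ∀ z v : ℝ × ℝ,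
      fderiv ℝ (fun z : ℝ × ℝ => φ z.1 * ψ z.2) z v =
        φ z.1 * (deriv ψ z.2 * v.2) + ψ z.2 * (deriv φ z.1 * v.1) := fun {φ ψ} h1 h2 z v => by
    have e1 : HasFDerivAt (fun z : ℝ × ℝ => φ z.1)
        (deriv φ z.1 • ContinuousLinearMap.fst ℝ ℝ ℝ) z :=
      (h1.differentiable (by norm_num) z.1).hasDerivAt.comp_hasFDerivAt z hasFDerivAt_fst
    have e2 : HasFDerivAt (fun z : ℝ × ℝ => ψ z.2)
        (deriv ψ z.2 • ContinuousLinearMap.snd ℝ ℝ ℝ) z :=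
      (h2.differentiable (by norm_num) z.2).hasDerivAt.comp_hasFDerivAt z hasFDerivAt_snd
    rw [(e1.fun_mul e2).fderiv]
    simp
  have hj : ∀ j, (fun (ψ : ℝ × ℝ → ℝ) z => fderiv ℝ ψ z (0, 1))^[j] (fun z => φ z.1 * ψ z.2) =
      fun z => φ z.1 * deriv^[j] ψ z.2 := fun j => by
    induction j with
    | zero => rfl
    | succ j ih =>
      rw [Function.iterate_succ_apply', ih, Function.iterate_succ_apply']
      ext z
      rw [hfst hφ (hψ.iterate_deriv j)]
      simp
  rw [partialDeriv, hj]
  induction i with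
  | zero => rfl
  | succ i ih =>
    rw [Function.iterate_succ_apply', ih, Function.iterate_succ_apply']
    ext z
    rw [hfst (hφ.iterate_deriv i) (hψ.iterate_deriv j)]
    simp [mul_comm]

theorem HasWeakDeriv.integral_tensor {J : Set ℝ} {i j : ℕ} {u w : ℝ × ℝ → X}
    (h : HasWeakDeriv (strip J) i j u w) {φ ψ : ℝ → ℝ} (hφ : ContDiff ℝ ∞ φ)
    (hφc : HasCompactSupport φ) (hφs : tsupport φ ⊆ I) (hψ : ContDiff ℝ ∞ ψ)
    (hψc : HasCompactSupport ψ) (hψs : tsupport ψ ⊆ J) :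
    ∫ z in strip J, (deriv^[i] φ z.1 * deriv^[j] ψ z.2) • u z =
      (-1 : ℝ) ^ (i + j) • ∫ z in strip J, (φ z.1 * ψ z.2) • w z := by
  have hsub : tsupport (fun z : ℝ × ℝ => φ z.1 * ψ z.2) ⊆ tsupport φ ×ˢ tsupport ψ := by
    refine closure_minimal (fun z hz => ?_) ((isClosed_tsupport _).prod (isClosed_tsupport _))
    exact ⟨subset_tsupport _ (left_ne_zero_of_mul hz), subset_tsupport _ (right_ne_zero_of_mul hz)⟩
  have := h.integral_eq (fun z => φ z.1 * ψ z.2)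
    ((hφ.comp contDiff_fst).mul (hψ.comp contDiff_snd))
    (HasCompactSupport.of_support_subset_isCompact (hφc.isCompact.prod hψc.isCompact)
      ((subset_tsupport _).trans hsub)) (hsub.trans (prod_mono hφs hψs))
  rwa [partialDeriv_mul hφ hψ] at this

theorem continuous_iterate_deriv {ψ : ℝ → ℝ} (hψ : ContDiff ℝ ∞ ψ) (j : ℕ) :
    Continuous (deriv^[j] ψ) := (hψ.iterate_deriv j).continuous

theorem hasCompactSupport_iterate_deriv {ψ : ℝ → ℝ} (hψ : HasCompactSupport ψ) (j : ℕ) :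
    HasCompactSupport (deriv^[j] ψ) := by
  induction j with
  | zero => exact hψ
  | succ j ih => rw [Function.iterate_succ_apply']; exact ih.deriv

theorem tsupport_iterate_deriv_subset (ψ : ℝ → ℝ) (j : ℕ) :
    tsupport (deriv^[j] ψ) ⊆ tsupport ψ := by
  induction j with
  | zero => exact subset_rfl
  | succ j ih => rw [Function.iterate_succ_apply']; exact (tsupport_deriv_subset).trans ih

theorem integrableOn_tensor_smul {J : Set ℝ} (hJ : MeasurableSet J) {u : ℝ × ℝ → X}
    (hu : IntegrableOn u (strip J))
    {θ ψ : ℝ → ℝ} (hθ : Continuous θ) (hψ : Continuous ψ) (hψc : HasCompactSupport ψ) :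
    IntegrableOn (fun z => (θ z.1 * ψ z.2) • u z) (strip J) := by
  obtain ⟨C, hC⟩ := isCompact_Icc.exists_bound_of_continuousOn
    (hθ.continuousOn (s := Icc 0 (2 * Real.pi)))
  obtain ⟨D, hD⟩ := hψc.exists_bound_of_continuous hψ
  refine Integrable.bdd_smul hu (C * D) (by fun_prop) ?_
  refine ae_restrict_of_forall_mem (measurableSet_Ioo.prod hJ) fun z hz => ?_
  rw [norm_mul]
  have := hC z.1 (Ioo_subset_Icc_self hz.1)
  exact mul_le_mul this (hD z.2) (norm_nonneg _) ((norm_nonneg _).trans this)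

/-- Smooth cutoff functions exhausting the interval `I`. -/
noncomputable def cutoff (k : ℕ) : ContDiffBump (Real.pi : ℝ) where
  -- The shifts `2` and `3` keep the inner radius positive already at `k = 0` and both radii below
  -- `π`, the distance from the centre to the ends of `I`; the inner radius tends to `π`.
  rIn := Real.pi * (1 - 1 / (k + 2))
  rOut := Real.pi * (1 - 1 / (k + 3))
  rIn_pos := by
    refine mul_pos Real.pi_pos (sub_pos.2 ?_)
    rw [div_lt_one (by positivity)]
    linarith [Nat.cast_nonneg (α := ℝ) k]
  rIn_lt_rOut := by
    refine mul_lt_mul_of_pos_left (sub_lt_sub_left ?_ _) Real.pi_pos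
    exact one_div_lt_one_div_of_lt (by positivity) (by linarith)

theorem tsupport_cutoff_subset (k : ℕ) : tsupport (cutoff k) ⊆ I := by
  rw [ContDiffBump.tsupport_eq, Real.closedBall_eq_Icc]
  have h : (cutoff k).rOut < Real.pi := by
    change Real.pi * (1 - 1 / ((k : ℝ) + 3)) < Real.pi
    have : (0 : ℝ) < 1 / ((k : ℝ) + 3) := by positivity
    nlinarith [Real.pi_pos]
  exact fun x hx => ⟨by linarith [hx.1], by linarith [hx.2]⟩

theorem tendsto_cutoff {x : ℝ} (hx : x ∈ I) :
    Tendsto (fun k => cutoff k x) atTop (𝓝 1) := by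
  refine tendsto_const_nhds.congr' ?_
  have hlim : Tendsto (fun k : ℕ => (cutoff k).rIn) atTop (𝓝 (Real.pi * (1 - 0))) := by
    refine (tendsto_const_nhds.sub ?_).const_mul _
    have := (tendsto_one_div_add_atTop_nhds_zero_nat (𝕜 := ℝ)).comp (tendsto_add_atTop_nat 1)
    refine this.congr fun k => ?_
    simp only [Function.comp_apply]
    push_cast
    ring
  have hlt : |x - Real.pi| < Real.pi * (1 - 0) := by
    rw [sub_zero, mul_one, abs_lt]
    exact ⟨by linarith [hx.1], by linarith [hx.2]⟩
  filter_upwards [hlim.eventually (lt_mem_nhds hlt)] with k hk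
  refine ((cutoff k).one_of_mem_closedBall ?_).symm
  rw [Metric.mem_closedBall, Real.dist_eq]
  exact hk.le

/-- Derivatives in `y` may be tested against functions that do not vanish on the lateral sides. -/
theorem HasWeakDeriv.integral_tensor_snd {J : Set ℝ} (hJ : MeasurableSet J) {j : ℕ}
    {u w : ℝ × ℝ → X} (h : HasWeakDeriv (strip J) 0 j u w) (hu : IntegrableOn u (strip J))
    (hw : IntegrableOn w (strip J)) {θ ψ : ℝ → ℝ} (hθ : ContDiff ℝ ∞ θ) (hψ : ContDiff ℝ ∞ ψ)
    (hψc : HasCompactSupport ψ) (hψs : tsupport ψ ⊆ J) :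
    ∫ z in strip J, (θ z.1 * deriv^[j] ψ z.2) • u z =
      (-1 : ℝ) ^ j • ∫ z in strip J, (θ z.1 * ψ z.2) • w z := by
  -- The cutoffs depend on `x` only, so they are untouched by derivatives in `y` and can be removed
  -- by dominated convergence.
  have key : ∀ {f : ℝ × ℝ → X} {ρ : ℝ → ℝ}, IntegrableOn f (strip J) → Continuous ρ →
      HasCompactSupport ρ → Tendsto (fun k => ∫ z in strip J,
        ((cutoff k z.1 * θ z.1) * ρ z.2) • f z) atTop
        (𝓝 (∫ z in strip J, (θ z.1 * ρ z.2) • f z)) := fun {f ρ} hf hρ hρc => by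
    have hint := integrableOn_tensor_smul hJ hf hθ.continuous hρ hρc
    refine tendsto_integral_of_dominated_convergence (fun z => ‖(θ z.1 * ρ z.2) • f z‖)
      (fun k => ?_) hint.norm (fun k => ae_of_all _ fun z => ?_) ?_
    · exact (integrableOn_tensor_smul hJ hf (((cutoff k).continuous).mul hθ.continuous) hρ
        hρc).aestronglyMeasurable
    · rw [mul_assoc, mul_smul, norm_smul]
      refine mul_le_of_le_one_left (norm_nonneg _) ?_
      rw [Real.norm_eq_abs, abs_of_nonneg (cutoff k).nonneg]
      exact (cutoff k).le_one
    · refine ae_restrict_of_forall_mem (measurableSet_Ioo.prod hJ) fun z hz => ?_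
      have := (((tendsto_cutoff hz.1).mul_const (θ z.1)).mul_const (ρ z.2)).smul_const (f z)
      rwa [one_mul] at this
  refine tendsto_nhds_unique (key hu (continuous_iterate_deriv hψ j)
    (hasCompactSupport_iterate_deriv hψc j)) ?_
  refine ((key hw hψ.continuous hψc).const_smul ((-1 : ℝ) ^ j)).congr fun k => ?_
  have := h.integral_tensor (φ := fun x => cutoff k x * θ x) ((cutoff k).contDiff.mul hθ)
    (cutoff k).hasCompactSupport.mul_right (tsupport_mul_subset_left.trans
      (tsupport_cutoff_subset k)) hψ hψc hψs
  rw [zero_add] at this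
  exact this.symm

/-! ### Green's formula on rectangles, up to the boundary and for traces. -/

/-- `w` is the weak derivative of `u` in the first variable on `A × B`, in the sense of the pairing
with the fixed weight `ψ` in the second variable. -/
def HasWeightedWeakDeriv (A B : Set ℝ) (ψ : ℝ → ℝ) (u w : ℝ × ℝ → X) : Prop :=
  ∀ φ : ℝ → ℝ, ContDiff ℝ ∞ φ → HasCompactSupport φ → tsupport φ ⊆ A →
    ∫ z in A ×ˢ B, (deriv φ z.1 * ψ z.2) • u z = -∫ z in A ×ˢ B, (φ z.1 * ψ z.2) • w z

theorem integrableOn_smul_rectangle {a b c d : ℝ} {u : ℝ × ℝ → X}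
    (hu : IntegrableOn u (Ioo a b ×ˢ Ioo c d)) {k : ℝ × ℝ → ℝ} (hk : Continuous k) :
    IntegrableOn (fun z => k z • u z) (Ioo a b ×ˢ Ioo c d) :=
  integrableOn_smul_of_subset_isCompact hu (measurableSet_Ioo.prod measurableSet_Ioo) hk
    (isCompact_Icc.prod isCompact_Icc) (prod_mono Ioo_subset_Icc_self Ioo_subset_Icc_self)

theorem setIntegral_tensor {A B : Set ℝ} {φ ψ : ℝ → ℝ} {f : ℝ × ℝ → X}
    (h : IntegrableOn (fun z => (φ z.1 * ψ z.2) • f z) (A ×ˢ B)) :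
    ∫ z in A ×ˢ B, (φ z.1 * ψ z.2) • f z = ∫ x in A, φ x • ∫ y in B, ψ y • f (x, y) := by
  rw [Measure.volume_eq_prod] at h ⊢
  rw [setIntegral_prod _ h]
  simp only [mul_smul, integral_smul]

theorem setIntegral_tensor_symm {A B : Set ℝ} {φ ψ : ℝ → ℝ} {f : ℝ × ℝ → X}
    (h : IntegrableOn (fun z => (φ z.1 * ψ z.2) • f z) (A ×ˢ B)) :
    ∫ z in A ×ˢ B, (φ z.1 * ψ z.2) • f z = ∫ y in B, ψ y • ∫ x in A, φ x • f (x, y) := by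
  rw [Measure.volume_eq_prod] at h ⊢
  rw [IntegrableOn, ← Measure.prod_restrict] at h
  rw [← Measure.prod_restrict, integral_prod_symm _ h]
  simp only [mul_comm (φ _), mul_smul, integral_smul]

/-- Green's formula on a rectangle for functions continuous up to the boundary. -/
theorem HasWeightedWeakDeriv.integral_eq_of_continuousOn [CompleteSpace X] {a b c d : ℝ}
    (hab : a < b) (hcd : c < d) {ψ β : ℝ → ℝ} (hψ : Continuous ψ) (hβ : ContDiff ℝ ∞ β)
    {v w : ℝ × ℝ → X} (hv : ContinuousOn v (Icc a b ×ˢ Icc c d))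
    (hw : IntegrableOn w (Ioo a b ×ˢ Ioo c d))
    (h : HasWeightedWeakDeriv (Ioo a b) (Ioo c d) ψ v w) :
    (∫ z in Ioo a b ×ˢ Ioo c d, (β z.1 * ψ z.2) • w z) +
      ∫ z in Ioo a b ×ˢ Ioo c d, (deriv β z.1 * ψ z.2) • v z =
    (β b • ∫ y in Ioo c d, ψ y • v (b, y)) - β a • ∫ y in Ioo c d, ψ y • v (a, y) := by
  have hvi : IntegrableOn v (Ioo a b ×ˢ Ioo c d) :=
    (hv.integrableOn_compact (isCompact_Icc.prod isCompact_Icc)).mono_set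
      (prod_mono Ioo_subset_Icc_self Ioo_subset_Icc_self)
  -- Integrating out `y` against `ψ` reduces the formula to one variable. Projecting onto the closed
  -- rectangle extends `v` continuously to the plane, which makes the parametric integral continuous
  -- up to the endpoints.
  have hV : ContinuousOn (fun x => ∫ y in Ioo c d, ψ y • v (x, y)) (Icc a b) := by
    have hcont : Continuous (Function.uncurry fun x y : ℝ =>
        ψ y • v (projIcc a b hab.le x, projIcc c d hcd.le y)) := by
      refine (hψ.comp continuous_snd).smul (hv.comp_continuous (by fun_prop) fun z => ?_)
      exact ⟨Subtype.prop _, Subtype.prop _⟩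
    refine (continuous_parametric_integral_of_continuous (μ := volume) hcont
      (isCompact_Icc (a := c) (b := d))).continuousOn.congr fun x hx => ?_
    beta_reduce
    rw [integral_Icc_eq_integral_Ioo]
    refine setIntegral_congr_fun measurableSet_Ioo fun y hy => ?_
    rw [projIcc_of_mem _ hx, projIcc_of_mem _ (Ioo_subset_Icc_self hy)]
  have hWi : IntegrableOn (fun x => ∫ y in Ioo c d, ψ y • w (x, y)) (Ioo a b) := by
    have := integrableOn_smul_rectangle hw (k := fun z => ψ z.2) (by fun_prop)
    rw [IntegrableOn, Measure.volume_eq_prod, ← Measure.prod_restrict] at this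
    exact this.integral_prod_left
  have hfub : ∀ {f : ℝ × ℝ → X} {φ : ℝ → ℝ}, IntegrableOn f (Ioo a b ×ˢ Ioo c d) → Continuous φ →
      ∫ z in Ioo a b ×ˢ Ioo c d, (φ z.1 * ψ z.2) • f z =
        ∫ x in Ioo a b, φ x • ∫ y in Ioo c d, ψ y • f (x, y) := fun {f φ} hf hφ =>
    setIntegral_tensor (integrableOn_smul_rectangle hf (by fun_prop))
  have hweak : IsWeakDerivOn (Ioo a b) (fun x => ∫ y in Ioo c d, ψ y • v (x, y))
      (fun x => ∫ y in Ioo c d, ψ y • w (x, y)) := fun φ hφ hφc hφs => by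
    rw [← hfub hvi (hφ.continuous_deriv (by norm_num)), ← hfub hw hφ.continuous]
    exact h φ hφ hφc hφs
  have hdβ : Continuous (deriv β) := hβ.continuous_deriv (by norm_num)
  rw [hfub hvi hdβ, hfub hw hβ.continuous, ← integral_add]
  · exact hweak.integral_smul_add_deriv_smul hab hβ hV hWi
  · exact integrableOn_smul_of_subset_isCompact hWi measurableSet_Ioo hβ.continuous isCompact_Icc
      Ioo_subset_Icc_self
  · exact integrableOn_smul_of_subset_isCompact
      (hV.integrableOn_Icc.mono_set Ioo_subset_Icc_self) measurableSet_Ioo hdβ isCompact_Icc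
      Ioo_subset_Icc_self

theorem tendsto_integral_smul_of_tendsto_lintegral {α : Type*} [TopologicalSpace α]
    [MeasurableSpace α] [OpensMeasurableSpace α] {μ : Measure α} {s K : Set α}
    (hs : MeasurableSet s) (hK : IsCompact K) (hsK : s ⊆ K) {k : α → ℝ} (hk : Continuous k)
    {F : ℕ → α → X} {f : α → X} (hF : ∀ n, IntegrableOn (F n) s μ) (hf : IntegrableOn f s μ)
    (h : Tendsto (fun n => ∫⁻ x in s, ‖F n x - f x‖ₑ ∂μ) atTop (𝓝 0)) :
    Tendsto (fun n => ∫ x in s, k x • F n x ∂μ) atTop (𝓝 (∫ x in s, k x • f x ∂μ)) := by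
  obtain ⟨C, hC⟩ := hK.exists_bound_of_continuousOn hk.continuousOn
  refine tendsto_integral_of_L1 _
    (integrableOn_smul_of_subset_isCompact hf hs hk hK hsK).aestronglyMeasurable
    (Eventually.of_forall fun n => integrableOn_smul_of_subset_isCompact (hF n) hs hk hK hsK) ?_
  have h0 : Tendsto (fun n => ENNReal.ofReal C * ∫⁻ x in s, ‖F n x - f x‖ₑ ∂μ) atTop (𝓝 0) := by
    have := ENNReal.Tendsto.const_mul h (Or.inr (ENNReal.ofReal_ne_top (r := C)))
    rwa [mul_zero] at this
  refine tendsto_of_tendsto_of_tendsto_of_le_of_le tendsto_const_nhds h0 (fun _ => zero_le)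
    fun n => ?_
  simp only
  rw [← lintegral_const_mul' _ _ ENNReal.ofReal_ne_top]
  refine setLIntegral_mono' hs fun x hx => ?_
  rw [← smul_sub, enorm_smul]
  gcongr
  rw [← ofReal_norm]
  exact ENNReal.ofReal_le_ofReal (hC x (hsK hx))

/-- Green's formula on a rectangle for a function with a trace on the side `{e} × (c, d)`. -/
theorem HasWeightedWeakDeriv.integral_eq_of_approx [CompleteSpace X] {a b c d e : ℝ}
    (hab : a < b) (hcd : c < d) (he : e = a ∨ e = b) {ψ β : ℝ → ℝ} (hψ : Continuous ψ)
    (hβ : ContDiff ℝ ∞ β) (hβ0 : β (a + b - e) = 0) {u w : ℝ × ℝ → X} {g : ℝ → X}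
    (hu : IntegrableOn u (Ioo a b ×ˢ Ioo c d)) (hw : IntegrableOn w (Ioo a b ×ˢ Ioo c d))
    (hg : IntegrableOn g (Ioo c d))
    (h : ∀ ε : ℝ≥0∞, 0 < ε → ∃ v v' : ℝ × ℝ → X, ContinuousOn v (Icc a b ×ˢ Icc c d) ∧
      IntegrableOn v' (Ioo a b ×ˢ Ioo c d) ∧
      HasWeightedWeakDeriv (Ioo a b) (Ioo c d) ψ v v' ∧
      ∫⁻ z in Ioo a b ×ˢ Ioo c d, ‖v z - u z‖ₑ ≤ ε ∧
      ∫⁻ z in Ioo a b ×ˢ Ioo c d, ‖v' z - w z‖ₑ ≤ ε ∧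
      ∫⁻ y in Ioo c d, ‖v (e, y) - g y‖ₑ ≤ ε) :
    (∫ z in Ioo a b ×ˢ Ioo c d, (β z.1 * ψ z.2) • w z) +
      ∫ z in Ioo a b ×ˢ Ioo c d, (deriv β z.1 * ψ z.2) • u z =
    (β b - β a) • ∫ y in Ioo c d, ψ y • g y := by
  -- At `n = 0` the tolerance is `⊤`, which imposes no bound and does not affect the limit.
  choose v v' hv hv' hweak h1 h2 h3 using fun n : ℕ =>
    h ((n : ℝ≥0∞)⁻¹) (ENNReal.inv_pos.2 (ENNReal.natCast_ne_top n))
  have hsq : ∀ {t : ℕ → ℝ≥0∞}, (∀ n : ℕ, t n ≤ (n : ℝ≥0∞)⁻¹) → Tendsto t atTop (𝓝 0) :=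
    fun {t} ht => tendsto_of_tendsto_of_tendsto_of_le_of_le tendsto_const_nhds
      ENNReal.tendsto_inv_nat_nhds_zero (fun _ => zero_le) ht
  have hdβ : Continuous (deriv β) := hβ.continuous_deriv (by norm_num)
  have hvi : ∀ n, IntegrableOn (v n) (Ioo a b ×ˢ Ioo c d) := fun n =>
    ((hv n).integrableOn_compact (isCompact_Icc.prod isCompact_Icc)).mono_set
      (prod_mono Ioo_subset_Icc_self Ioo_subset_Icc_self)
  have heI : e ∈ Icc a b := by
    rcases he with rfl | rfl
    · exact left_mem_Icc.2 hab.le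
    · exact right_mem_Icc.2 hab.le
  have hve : ∀ n, IntegrableOn (fun y => v n (e, y)) (Ioo c d) := fun n =>
    (((hv n).comp (by fun_prop : Continuous fun y : ℝ => (e, y)).continuousOn
      fun y hy => ⟨heI, hy⟩).integrableOn_Icc).mono_set Ioo_subset_Icc_self
  have hR : MeasurableSet (Ioo a b ×ˢ Ioo c d) := measurableSet_Ioo.prod measurableSet_Ioo
  have hK : IsCompact (Icc a b ×ˢ Icc c d) := isCompact_Icc.prod isCompact_Icc
  have hRK : Ioo a b ×ˢ Ioo c d ⊆ Icc a b ×ˢ Icc c d :=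
    prod_mono Ioo_subset_Icc_self Ioo_subset_Icc_self
  refine tendsto_nhds_unique
    ((tendsto_integral_smul_of_tendsto_lintegral hR hK hRK (k := fun z => β z.1 * ψ z.2)
      (by fun_prop) hv' hw (hsq h2)).add
    (tendsto_integral_smul_of_tendsto_lintegral hR hK hRK (k := fun z => deriv β z.1 * ψ z.2)
      (by fun_prop) hvi hu (hsq h1))) ?_
  refine ((tendsto_integral_smul_of_tendsto_lintegral measurableSet_Ioo isCompact_Icc
    Ioo_subset_Icc_self hψ hve hg (hsq h3)).const_smul (β b - β a)).congr fun n => ?_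
  rw [(hweak n).integral_eq_of_continuousOn hab hcd hψ hβ (hv n) (hv' n)]
  -- `β` vanishes at `a + b - e`, the endpoint opposite to `e`, so only the side carrying the trace
  -- contributes; the factor `β b - β a` has the right sign in both cases.
  rcases he with rfl | rfl
  · rw [add_sub_cancel_left] at hβ0
    rw [hβ0, zero_sub, zero_smul, zero_sub, neg_smul]
  · rw [add_sub_cancel_right] at hβ0
    rw [hβ0, sub_zero, zero_smul, sub_zero]

theorem HasWeightedWeakDeriv.add {a b c d : ℝ} {ψ : ℝ → ℝ} (hψ : Continuous ψ)
    {u w u' w' : ℝ × ℝ → X} (h : HasWeightedWeakDeriv (Ioo a b) (Ioo c d) ψ u w)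
    (h' : HasWeightedWeakDeriv (Ioo a b) (Ioo c d) ψ u' w')
    (hu : IntegrableOn u (Ioo a b ×ˢ Ioo c d)) (hw : IntegrableOn w (Ioo a b ×ˢ Ioo c d))
    (hu' : IntegrableOn u' (Ioo a b ×ˢ Ioo c d)) (hw' : IntegrableOn w' (Ioo a b ×ˢ Ioo c d)) :
    HasWeightedWeakDeriv (Ioo a b) (Ioo c d) ψ (u + u') (w + w') := by
  intro φ hφ hφc hφs
  have hd : Continuous (deriv φ) := hφ.continuous_deriv (by norm_num)
  have hc := hφ.continuous
  simp only [Pi.add_apply, smul_add]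
  rw [integral_add (integrableOn_smul_rectangle hu (k := fun z => deriv φ z.1 * ψ z.2)
      (by fun_prop)) (integrableOn_smul_rectangle hu' (k := fun z => deriv φ z.1 * ψ z.2)
      (by fun_prop)), integral_add (integrableOn_smul_rectangle hw (k := fun z => φ z.1 * ψ z.2)
      (by fun_prop)) (integrableOn_smul_rectangle hw' (k := fun z => φ z.1 * ψ z.2)
      (by fun_prop)), h φ hφ hφc hφs, h' φ hφ hφc hφs, neg_add]

theorem setIntegral_strip_eq {J J' : Set ℝ} (hJ : MeasurableSet J) (hJJ : J' ⊆ J) {θ ψ : ℝ → ℝ}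
    (hψ : tsupport ψ ⊆ J') (f : ℝ × ℝ → X) :
    ∫ z in strip J, (θ z.1 * ψ z.2) • f z = ∫ z in strip J', (θ z.1 * ψ z.2) • f z := by
  refine setIntegral_eq_of_subset_of_forall_sdiff_eq_zero (measurableSet_Ioo.prod hJ)
    (prod_mono subset_rfl hJJ) fun z hz => ?_
  have : ψ z.2 = 0 := image_eq_zero_of_notMem_tsupport fun h' => hz.2 ⟨hz.1.1, hψ h'⟩
  rw [this, mul_zero, zero_smul]

theorem closure_strip_Ioo {ξ : ℝ} (hξ : 0 < ξ) :
    closure (strip (Ioo 0 ξ)) = Icc 0 (2 * Real.pi) ×ˢ Icc 0 ξ := by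
  rw [strip, closure_prod_eq, I, closure_Ioo Real.two_pi_pos.ne, closure_Ioo hξ.ne]

/-! ### Green's formulas for the lateral and base traces. -/

/-- An approximation of `u` in the norm of `W^1_{p,1}` is an approximation of `u` and of one of its
first derivatives in `L^1`. -/
theorem exists_approx_of_mixedSobolevNorm_lt [CompleteSpace X] {p : ℝ≥0∞} (hp : 1 ≤ p)
    {J : Set ℝ} (hJ : IsOpen J) {v u : ℝ × ℝ → X} {ε : ℝ≥0∞} (hε : ε ≠ ⊤)
    (hv : IntegrableOn v (strip J)) (hu : IntegrableOn u (strip J))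
    (h : mixedSobolevNorm 1 p J (v - u) < ε / embeddingConst p) {i j : ℕ} (hij : i + j ≤ 1) :
    ∫⁻ z in strip J, ‖v z - u z‖ₑ ≤ ε ∧ ∃ w, HasWeakDeriv (strip J) i j (v - u) w ∧
      IntegrableOn w (strip J) ∧ ∫⁻ z in strip J, ‖w z‖ₑ ≤ ε := by
  have key : ∀ {i j : ℕ}, i + j ≤ 1 → ∃ w, HasWeakDeriv (strip J) i j (v - u) w ∧
      IntegrableOn w (strip J) ∧ ∫⁻ z in strip J, ‖w z‖ₑ ≤ ε := fun {i j} hij => by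
    obtain ⟨w, hw, hwn⟩ := exists_hasWeakDeriv_mixedNorm_lt h hij
    have hm := hw.locallyIntegrable_deriv.aestronglyMeasurable
    have hle : ∫⁻ z in strip J, ‖w z‖ₑ ≤ ε :=
      (lintegral_enorm_le_mixedNorm hp hm).trans ((mul_le_mul_left hwn.le _).trans_eq
        (ENNReal.div_mul_cancel (embeddingConst_ne_zero p) (embeddingConst_ne_top p)))
    exact ⟨w, hw, ⟨hm, hle.trans_lt hε.lt_top⟩, hle⟩
  refine ⟨?_, key hij⟩
  obtain ⟨w, hw, -, hle⟩ := key (i := 0) (j := 0) (Nat.zero_le _)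
  refine (lintegral_congr_ae ?_).trans_le hle
  filter_upwards [(HasWeakDeriv.refl (hv.sub hu).locallyIntegrableOn).ae_eq (isOpen_strip hJ) hw]
    with z hz
  rw [← hz, Pi.sub_apply]

/-- Green's formula in `x` for a function with a lateral trace. -/
theorem HasLateralTrace.integral_eq [CompleteSpace X] {p : ℝ≥0∞} (hp : 1 ≤ p) {a : ℝ}
    (ha : a = 0 ∨ a = 2 * Real.pi) {u w : ℝ × ℝ → X} {g : ℝ → X} (h : HasLateralTrace p a u g)
    (hw : IntegrableOn w (strip (Ioi 0))) {ψ β : ℝ → ℝ} (hψ : ContDiff ℝ ∞ ψ)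
    (hψc : HasCompactSupport ψ) (hψs : tsupport ψ ⊆ Ioi 0)
    (huw : HasWeightedWeakDeriv I (Ioi 0) ψ u w) (hβ : ContDiff ℝ ∞ β)
    (hβ0 : β (2 * Real.pi - a) = 0) :
    (∫ z in strip (Ioi 0), (β z.1 * ψ z.2) • w z) +
      ∫ z in strip (Ioi 0), (deriv β z.1 * ψ z.2) • u z =
    (β (2 * Real.pi) - β 0) • ∫ y, ψ y • g y := by
  have hu := h.1.integrableOn_self hp isOpen_Ioi
  obtain ⟨ξ, hξ, hψξ⟩ : ∃ ξ : ℝ, 0 < ξ ∧ tsupport ψ ⊆ Ioo 0 ξ := by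
    obtain ⟨M, hM⟩ := hψc.isCompact.bddAbove
    exact ⟨max M 0 + 1, by positivity, fun y hy => ⟨hψs hy,
      ((hM hy).trans (le_max_left M 0)).trans_lt (lt_add_one _)⟩⟩
  have hsub : Ioo 0 ξ ⊆ Ioi 0 := Ioo_subset_Ioi_self
  have hsub' : strip (Ioo 0 ξ) ⊆ strip (Ioi 0) := prod_mono subset_rfl hsub
  have huξ := hu.mono_set hsub'
  have hwξ := hw.mono_set hsub'
  obtain ⟨hg, v, hv, hvn, hvg⟩ := h.2 ξ hξ
  have huw' : HasWeightedWeakDeriv I (Ioo 0 ξ) ψ u w := fun φ h1 h2 h3 => by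
    have := huw φ h1 h2 h3
    rwa [← strip, setIntegral_strip_eq measurableSet_Ioi hsub hψξ,
      setIntegral_strip_eq measurableSet_Ioi hsub hψξ] at this
  rw [setIntegral_strip_eq measurableSet_Ioi hsub hψξ,
    setIntegral_strip_eq measurableSet_Ioi hsub hψξ, ← setIntegral_smul_eq_integral volume hψξ]
  refine HasWeightedWeakDeriv.integral_eq_of_approx Real.two_pi_pos hξ ha hψ.continuous hβ
    (by rwa [zero_add]) huξ hwξ hg fun ε hε => ?_
  wlog hεt : ε ≠ ⊤ generalizing ε
  · obtain ⟨v, v', h1, h2, h3, h4, h5, h6⟩ := this 1 one_pos ENNReal.one_ne_top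
    rw [not_not.1 hεt]
    exact ⟨v, v', h1, h2, h3, le_top, le_top, le_top⟩
  obtain ⟨n, hn1, hn2⟩ := ((hvn.eventually (gt_mem_nhds (ENNReal.div_pos hε.ne'
    (embeddingConst_ne_top p)))).and (hvg.eventually (gt_mem_nhds hε))).exists
  have hvc := (hv n).2
  rw [closure_strip_Ioo hξ] at hvc
  have hvi : IntegrableOn (v n) (strip (Ioo 0 ξ)) := (hv n).1.integrableOn_self hp isOpen_Ioo
  obtain ⟨hle, v', hv', hv'i, hv'n⟩ := exists_approx_of_mixedSobolevNorm_lt hp isOpen_Ioo hεt hvi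
    huξ hn1 (i := 1) (j := 0) le_rfl
  -- The Sobolev norm controls a weak derivative `v'` of the difference `v n - u`; adding `w` gives
  -- a weighted weak derivative of `v n` itself.
  refine ⟨v n, v' + w, hvc, hv'i.add hwξ, ?_, hle, ?_, ?_⟩
  · have hweak : HasWeightedWeakDeriv I (Ioo 0 ξ) ψ (v n - u) v' := fun φ h1 h2 h3 => by
      simpa [strip] using hv'.integral_tensor h1 h2 h3 hψ hψc hψξ
    have := hweak.add hψ.continuous huw' (hvi.sub huξ) hv'i huξ hwξ
    rwa [sub_add_cancel] at this
  · simpa [strip, I] using hv'n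
  · rw [eLpNorm_one_eq_lintegral_enorm] at hn2
    exact hn2.le

/-- Green's formula in `y` for a function with a trace on the base. -/
theorem HasBaseTrace.integral_eq [CompleteSpace X] {p : ℝ≥0∞} (hp : 1 ≤ p) {u w : ℝ × ℝ → X}
    {g : ℝ → X} (h : HasBaseTrace p u g) (hw : IntegrableOn w (strip (Ioi 0)))
    (huw : HasWeakDeriv (strip (Ioi 0)) 0 1 u w) {θ β : ℝ → ℝ} (hθ : ContDiff ℝ ∞ θ)
    (hβ : ContDiff ℝ ∞ β) {ξ : ℝ} (hξ : 0 < ξ) (hβ0 : β ξ = 0) :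
    (∫ z in strip (Ioo 0 ξ), (θ z.1 * β z.2) • w z) +
      ∫ z in strip (Ioo 0 ξ), (θ z.1 * deriv β z.2) • u z = (-β 0) • ∫ x in I, θ x • g x := by
  have hu := h.1.integrableOn_self hp isOpen_Ioi
  have hsub : Ioo 0 ξ ⊆ Ioi 0 := Ioo_subset_Ioi_self
  have hsub' : strip (Ioo 0 ξ) ⊆ strip (Ioi 0) := prod_mono subset_rfl hsub
  have huξ := hu.mono_set hsub'
  have hwξ := hw.mono_set hsub'
  obtain ⟨-, hg, h⟩ := h
  obtain ⟨v, hv, hvn, hvg⟩ := h ξ hξ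
  -- The rectangle formula differentiates in the first variable, so the coordinates are exchanged.
  have hswap : ∀ (φ : ℝ → ℝ) (f : ℝ × ℝ → X), ∫ z in strip (Ioo 0 ξ), (θ z.1 * φ z.2) • f z =
      ∫ z in Ioo 0 ξ ×ˢ I, (φ z.1 * θ z.2) • f z.swap := fun φ f => by
    have := setIntegral_prod_swap (μ := volume) (ν := volume) I (Ioo 0 ξ)
      (fun z : ℝ × ℝ => (θ z.1 * φ z.2) • f z)
    simp only [Prod.fst_swap, Prod.snd_swap, ← Measure.volume_eq_prod, mul_comm (θ _)] at this
    rw [this, strip]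
    simp only [mul_comm (θ _)]
  have hlswap : ∀ {f : ℝ × ℝ → X}, IntegrableOn f (strip (Ioo 0 ξ)) →
      ∫⁻ z in Ioo 0 ξ ×ˢ I, ‖f z.swap‖ₑ = ∫⁻ z in strip (Ioo 0 ξ), ‖f z‖ₑ := fun {f} hf => by
    have hm := hf.1
    rw [strip, Measure.volume_eq_prod, ← Measure.prod_restrict] at hm ⊢
    rw [← Measure.prod_restrict]
    exact lintegral_prod_swap (fun z => ‖f z‖ₑ)
  have hiswap : ∀ {f : ℝ × ℝ → X}, IntegrableOn f (strip (Ioo 0 ξ)) →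
      IntegrableOn (fun z => f z.swap) (Ioo 0 ξ ×ˢ I) := fun {f} hf => IntegrableOn.swap hf
  have huw' : HasWeightedWeakDeriv (Ioo 0 ξ) I θ (fun z => u z.swap) (fun z => w z.swap) :=
    fun φ h1 h2 h3 => by
    have := huw.integral_tensor_snd measurableSet_Ioi hu hw hθ h1 h2 (h3.trans hsub)
    rw [setIntegral_strip_eq measurableSet_Ioi hsub ((tsupport_iterate_deriv_subset φ 1).trans h3),
      setIntegral_strip_eq measurableSet_Ioi hsub h3, hswap, hswap] at this
    simpa using this
  have hgi : IntegrableOn g I := by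
    have : IsFiniteMeasure (volume.restrict I) :=
      ⟨by rw [volume_restrict_I_univ]; exact ENNReal.ofReal_lt_top⟩
    exact hg.integrable hp
  rw [hswap, hswap, show -β 0 = β ξ - β 0 by rw [hβ0, zero_sub]]
  refine HasWeightedWeakDeriv.integral_eq_of_approx (e := 0) hξ Real.two_pi_pos (Or.inl rfl)
    hθ.continuous hβ (by rwa [zero_add, sub_zero]) (hiswap huξ) (hiswap hwξ)
    hgi fun ε hε => ?_
  wlog hεt : ε ≠ ⊤ generalizing ε
  · obtain ⟨v, v', h1, h2, h3, h4, h5, h6⟩ := this 1 one_pos ENNReal.one_ne_top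
    rw [not_not.1 hεt]
    exact ⟨v, v', h1, h2, h3, le_top, le_top, le_top⟩
  -- The base trace converges in `L^p`, so here the trace error also pays the embedding constant.
  have hδ : 0 < ε / embeddingConst p := ENNReal.div_pos hε.ne' (embeddingConst_ne_top p)
  obtain ⟨n, hn1, hn2⟩ := ((hvn.eventually (gt_mem_nhds hδ)).and
    (hvg.eventually (gt_mem_nhds hδ))).exists
  have hvc := (hv n).2
  rw [closure_strip_Ioo hξ] at hvc
  have hvi : IntegrableOn (v n) (strip (Ioo 0 ξ)) := (hv n).1.integrableOn_self hp isOpen_Ioo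
  obtain ⟨hle, v', hv', hv'i, hv'n⟩ := exists_approx_of_mixedSobolevNorm_lt hp isOpen_Ioo hεt hvi
    huξ hn1 (i := 0) (j := 1) le_rfl
  refine ⟨fun z => v n z.swap, (fun z => v' z.swap) + fun z => w z.swap,
    hvc.comp continuous_swap.continuousOn fun z hz => ⟨hz.2, hz.1⟩,
    (hiswap hv'i).add (hiswap hwξ), ?_, ?_, ?_, ?_⟩
  · have hweak : HasWeightedWeakDeriv (Ioo 0 ξ) I θ (fun z => (v n - u) z.swap)
        (fun z => v' z.swap) := fun φ h1 h2 h3 => by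
      have := hv'.integral_tensor_snd measurableSet_Ioo (hvi.sub huξ) hv'i hθ h1 h2 h3
      rw [hswap, hswap] at this
      simpa using this
    have := hweak.add hθ.continuous huw' (hiswap (hvi.sub huξ)) (hiswap hv'i) (hiswap huξ)
      (hiswap hwξ)
    convert this using 1
    ext z
    simp
  · exact (hlswap (hvi.sub huξ)).trans_le hle
  · simpa [I] using (hlswap hv'i).trans_le hv'n
  · have hm : AEStronglyMeasurable (fun x => v n (x, 0) - g x) (volume.restrict I) := by
      refine AEStronglyMeasurable.sub ?_ hg.1
      refine (((hvc.comp (by fun_prop : Continuous fun x : ℝ => (x, (0 : ℝ))).continuousOn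
        fun x hx => ⟨hx, left_mem_Icc.2 hξ.le⟩).integrableOn_Icc (μ := volume)).mono_set
        Ioo_subset_Icc_self).aestronglyMeasurable
    exact (lintegral_enorm_le_eLpNorm hp hm).trans ((mul_le_mul_left hn2.le _).trans_eq
      (ENNReal.div_mul_cancel (embeddingConst_ne_zero p) (embeddingConst_ne_top p)))

/-! ### From the boundary value problem to integral identities. -/

theorem contDiff_deriv {k : ℝ → ℝ} (hk : ContDiff ℝ ∞ k) : ContDiff ℝ ∞ (deriv k) :=
  hk.iterate_deriv 1

/-- The identities satisfied by a solution with datum `f`, in terms of integrals of the solution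
`u` and of its derivative `w` in `y` only. -/
structure IsIntegralSolution (f : ℝ → X) (u w : ℝ × ℝ → X) : Prop where
  integrableOn : IntegrableOn u (strip (Ioi 0))
  integrableOn_deriv : IntegrableOn w (strip (Ioi 0))
  weakDeriv : ∀ θ ψ : ℝ → ℝ, ContDiff ℝ ∞ θ → ContDiff ℝ ∞ ψ → HasCompactSupport ψ →
    tsupport ψ ⊆ Ioi 0 → ∫ z in strip (Ioi 0), (θ z.1 * deriv ψ z.2) • u z =
      -∫ z in strip (Ioi 0), (θ z.1 * ψ z.2) • w z
  laplace : ∀ θ ψ : ℝ → ℝ, ContDiff ℝ ∞ θ → θ (2 * Real.pi) = 0 →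
    deriv θ 0 = deriv θ (2 * Real.pi) → ContDiff ℝ ∞ ψ → HasCompactSupport ψ →
    tsupport ψ ⊆ Ioi 0 → ∫ z in strip (Ioi 0), (θ z.1 * deriv (deriv ψ) z.2) • u z =
      -∫ z in strip (Ioi 0), (deriv (deriv θ) z.1 * ψ z.2) • u z
  base : ∀ θ β : ℝ → ℝ, ContDiff ℝ ∞ θ → ContDiff ℝ ∞ β → β 1 = 0 →
    (∫ z in strip (Ioo 0 1), (θ z.1 * β z.2) • w z) +
      ∫ z in strip (Ioo 0 1), (θ z.1 * deriv β z.2) • u z = (-β 0) • ∫ x in I, θ x • f x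

theorem IsSolution.exists_isIntegralSolution [CompleteSpace X] {p : ℝ≥0∞} (hp : 1 ≤ p)
    {f : ℝ → X} {u : ℝ × ℝ → X} (h : IsSolution p f u) : ∃ w, IsIntegralSolution f u w := by
  obtain ⟨uxx, uyy, hxx, hyy, hlap⟩ := h.laplace
  obtain ⟨ux, hx, hflux⟩ := h.flux
  obtain ⟨g, hg0, hg1⟩ := h.periodic
  obtain ⟨uy, hy, -⟩ := h.mem 0 1 (by norm_num)
  have hJ : IsOpen (Ioi (0 : ℝ)) := isOpen_Ioi
  have hui := h.mem.integrableOn_self hp hJ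
  have hxi := h.mem.integrableOn hp hJ (by norm_num) hx
  have hyi := h.mem.integrableOn hp hJ (by norm_num) hy
  have hxxi := h.mem.integrableOn hp hJ (by norm_num) hxx
  have hyyi := h.mem.integrableOn hp hJ (by norm_num) hyy
  refine ⟨uy, hui, hyi, fun θ ψ hθ hψ hψc hψs => ?_, fun θ ψ hθ hθ0 hθ1 hψ hψc hψs => ?_,
    fun θ β hθ hβ hβ0 => h.base.integral_eq hp hyi hy hθ hβ one_pos hβ0⟩
  · simpa using hy.integral_tensor_snd measurableSet_Ioi hui hyi hθ hψ hψc hψs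
  have hθ' : ContDiff ℝ ∞ (deriv θ) := contDiff_deriv hθ
  have hwx : HasWeightedWeakDeriv I (Ioi 0) ψ u ux := fun φ h1 h2 h3 => by
    simpa [strip] using hx.integral_tensor h1 h2 h3 hψ hψc hψs
  -- The weak derivative of order two refers to `u`, not to `ux`. Testing the first-order formula
  -- with `φ'` shows that `uxx` is the derivative of `ux` in the weighted sense, which is all that
  -- Green's formula needs.
  have hwxx : HasWeightedWeakDeriv I (Ioi 0) ψ ux uxx := fun φ h1 h2 h3 => by
    have e1 := hwx (deriv φ) (contDiff_deriv h1) h2.deriv (tsupport_deriv_subset.trans h3)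
    have e2 := hxx.integral_tensor h1 h2 h3 hψ hψc hψs
    simp only [Function.iterate_succ, Function.iterate_zero, Function.comp_apply, id_eq, add_zero,
      even_two, Even.neg_pow, one_pow, one_smul] at e2
    rw [← strip] at e1 ⊢
    rw [← e2, e1, neg_neg]
  have e1 := hyy.integral_tensor_snd measurableSet_Ioi hui hyyi hθ hψ hψc hψs
  simp only [Function.iterate_succ, Function.iterate_zero, Function.comp_apply, id_eq,
    even_two, Even.neg_pow, one_pow, one_smul] at e1
  have e2 : ∫ z in strip (Ioi 0), (θ z.1 * ψ z.2) • uyy z =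
      -∫ z in strip (Ioi 0), (θ z.1 * ψ z.2) • uxx z := by
    rw [← integral_neg]
    refine integral_congr_ae ?_
    filter_upwards [hlap] with z hz
    rw [← smul_neg, eq_neg_of_add_eq_zero_right hz]
  -- No boundary term: `θ` vanishes at `2π` and the trace of `ux` vanishes at `0`.
  have e3 := hflux.integral_eq hp (Or.inl rfl) hxxi hψ hψc hψs hwxx hθ (by rwa [sub_zero])
  simp only [smul_zero, integral_zero] at e3
  -- The one-sided formulas need weights vanishing on the opposite side, so `θ'` is split by the
  -- partition `x/(2π) + (1 - x/(2π)) = 1`. The two boundary terms involve the same trace `g` and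
  -- add up to `(θ'(2π) - θ'(0)) ∫ ψ g = 0`.
  have hlin : ContDiff ℝ ∞ fun x : ℝ => x / (2 * Real.pi) := by fun_prop
  have hlin' : ContDiff ℝ ∞ fun x : ℝ => 1 - x / (2 * Real.pi) := by fun_prop
  have e4 := hg1.integral_eq hp (Or.inr rfl) hxi hψ hψc hψs hwx
    (β := fun x => x / (2 * Real.pi) * deriv θ x) (hlin.mul hθ') (by simp)
  have e5 := hg0.integral_eq hp (Or.inl rfl) hxi hψ hψc hψs hwx
    (β := fun x => (1 - x / (2 * Real.pi)) * deriv θ x) (hlin'.mul hθ')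
    (by simp)
  have hint : ∀ {k : ℝ → ℝ} {f : ℝ × ℝ → X}, ContDiff ℝ ∞ k → IntegrableOn f (strip (Ioi 0)) →
      IntegrableOn (fun z => (k z.1 * ψ z.2) • f z) (strip (Ioi 0)) := fun hk hf =>
    integrableOn_tensor_smul measurableSet_Ioi hf hk.continuous hψ.continuous hψc
  have e6 : (∫ z in strip (Ioi 0), (deriv θ z.1 * ψ z.2) • ux z) +
      ∫ z in strip (Ioi 0), (deriv (deriv θ) z.1 * ψ z.2) • u z = 0 := by
    have hs := congr($e4 + $e5)
    rw [add_add_add_comm, ← integral_add (hint (hlin.mul hθ') hxi) (hint (hlin'.mul hθ') hxi),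
      ← integral_add (hint (contDiff_deriv (hlin.mul hθ')) hui)
        (hint (contDiff_deriv (hlin'.mul hθ')) hui)] at hs
    have hdsum : ∀ x, deriv (fun x => x / (2 * Real.pi) * deriv θ x) x +
        deriv (fun x => (1 - x / (2 * Real.pi)) * deriv θ x) x = deriv (deriv θ) x := fun x => by
      rw [← deriv_fun_add ((hlin.mul hθ').differentiable (by norm_num) x)
        ((hlin'.mul hθ').differentiable (by norm_num) x)]
      congr 1
      ext x
      ring
    simp only [← add_smul, ← add_mul, hdsum] at hs
    simp only [add_sub_cancel, one_mul] at hs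
    rw [hs]
    simp [hθ1]
  rw [e1, e2, eq_neg_of_add_eq_zero_left e3, neg_neg, eq_neg_of_add_eq_zero_left e6]

theorem IsIntegralSolution.sub {f : ℝ → X} {u u' w w' : ℝ × ℝ → X}
    (h : IsIntegralSolution f u w) (h' : IsIntegralSolution f u' w') :
    IsIntegralSolution (fun _ => (0 : X)) (u - u') (w - w') := by
  have key : ∀ {θ ψ : ℝ → ℝ} {v v' : ℝ × ℝ → X}, ContDiff ℝ ∞ θ → ContDiff ℝ ∞ ψ →
      HasCompactSupport ψ → IntegrableOn v (strip (Ioi 0)) → IntegrableOn v' (strip (Ioi 0)) →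
      ∫ z in strip (Ioi 0), (θ z.1 * ψ z.2) • (v - v') z =
        (∫ z in strip (Ioi 0), (θ z.1 * ψ z.2) • v z) -
          ∫ z in strip (Ioi 0), (θ z.1 * ψ z.2) • v' z := fun {θ ψ v v'} hθ hψ hψc hv hv' => by
    simp only [Pi.sub_apply, smul_sub]
    exact integral_sub (integrableOn_tensor_smul measurableSet_Ioi hv hθ.continuous hψ.continuous
      hψc) (integrableOn_tensor_smul measurableSet_Ioi hv' hθ.continuous hψ.continuous hψc)
  have hsub : strip (Ioo 0 1) ⊆ strip (Ioi 0) := prod_mono subset_rfl Ioo_subset_Ioi_self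
  have key' : ∀ {θ ψ : ℝ → ℝ} {v v' : ℝ × ℝ → X}, ContDiff ℝ ∞ θ → ContDiff ℝ ∞ ψ →
      IntegrableOn v (strip (Ioi 0)) → IntegrableOn v' (strip (Ioi 0)) →
      ∫ z in strip (Ioo 0 1), (θ z.1 * ψ z.2) • (v - v') z =
        (∫ z in strip (Ioo 0 1), (θ z.1 * ψ z.2) • v z) -
          ∫ z in strip (Ioo 0 1), (θ z.1 * ψ z.2) • v' z := fun {θ ψ v v'} hθ hψ hv hv' => by
    have hk : Continuous fun z : ℝ × ℝ => θ z.1 * ψ z.2 :=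
      (hθ.continuous.comp continuous_fst).mul (hψ.continuous.comp continuous_snd)
    simp only [Pi.sub_apply, smul_sub]
    exact integral_sub (integrableOn_smul_rectangle (hv.mono_set hsub) hk)
      (integrableOn_smul_rectangle (hv'.mono_set hsub) hk)
  have hu := h.integrableOn
  have hu' := h'.integrableOn
  have hw := h.integrableOn_deriv
  have hw' := h'.integrableOn_deriv
  refine ⟨hu.sub hu', hw.sub hw', fun θ ψ hθ hψ hψc hψs => ?_,
    fun θ ψ hθ hθ0 hθ1 hψ hψc hψs => ?_, fun θ β hθ hβ hβ0 => ?_⟩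
  · rw [key hθ (contDiff_deriv hψ) hψc.deriv hu hu', key hθ hψ hψc hw hw',
      h.weakDeriv θ ψ hθ hψ hψc hψs,
      h'.weakDeriv θ ψ hθ hψ hψc hψs]
    abel
  · rw [key hθ (contDiff_deriv (contDiff_deriv hψ)) hψc.deriv.deriv hu hu',
      key (contDiff_deriv (contDiff_deriv hθ)) hψ hψc hu hu',
      h.laplace θ ψ hθ hθ0 hθ1 hψ hψc hψs, h'.laplace θ ψ hθ hθ0 hθ1 hψ hψc hψs]
    abel
  · rw [key' hθ hβ hw hw', key' hθ (contDiff_deriv hβ) hu hu', sub_add_sub_comm,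
      h.base θ β hθ hβ hβ0,
      h'.base θ β hθ hβ hβ0]
    simp

/-! ### Vanishing of the coefficients and of the solution. -/

/-- The coefficient of a homogeneous solution against a function `θ` of the adjoint system solves
`v'' = k² v` and therefore vanishes. -/
theorem IsIntegralSolution.ae_integral_smul_eq_zero [CompleteSpace X] {u w : ℝ × ℝ → X}
    (h : IsIntegralSolution (fun _ => (0 : X)) u w) {θ : ℝ → ℝ} (hθ : ContDiff ℝ ∞ θ)
    (hθ0 : θ (2 * Real.pi) = 0) (hθ1 : deriv θ 0 = deriv θ (2 * Real.pi)) {k : ℝ} (hk : 0 ≤ k)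
    (hθ2 : ∀ ψ : ℝ → ℝ, ContDiff ℝ ∞ ψ → HasCompactSupport ψ →
      ∫ z in strip (Ioi 0), (deriv (deriv θ) z.1 * ψ z.2) • u z =
        -(k ^ 2 • ∫ z in strip (Ioi 0), (θ z.1 * ψ z.2) • u z)) :
    ∀ᵐ y ∂volume.restrict (Ioi 0), ∫ x in I, θ x • u (x, y) = 0 := by
  have hfub : ∀ {f : ℝ × ℝ → X} {ψ : ℝ → ℝ}, IntegrableOn f (strip (Ioi 0)) → ContDiff ℝ ∞ ψ →
      HasCompactSupport ψ → ∫ z in strip (Ioi 0), (θ z.1 * ψ z.2) • f z =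
        ∫ y in Ioi 0, ψ y • ∫ x in I, θ x • f (x, y) := fun hf hψ hψc =>
    setIntegral_tensor_symm (integrableOn_tensor_smul measurableSet_Ioi hf hθ.continuous
      hψ.continuous hψc)
  have hi : ∀ {f : ℝ × ℝ → X}, IntegrableOn f (strip (Ioi 0)) →
      IntegrableOn (fun y => ∫ x in I, θ x • f (x, y)) (Ioi 0) := fun {f} hf => by
    obtain ⟨C, hC⟩ := isCompact_Icc.exists_bound_of_continuousOn
      (hθ.continuous.continuousOn (s := Icc 0 (2 * Real.pi)))
    have : IntegrableOn (fun z : ℝ × ℝ => θ z.1 • f z) (strip (Ioi 0)) :=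
      Integrable.bdd_smul (φ := fun z : ℝ × ℝ => θ z.1) hf C
        (hθ.continuous.comp continuous_fst).aestronglyMeasurable
        (ae_restrict_of_forall_mem (measurableSet_Ioo.prod measurableSet_Ioi) fun z hz =>
          hC z.1 (Ioo_subset_Icc_self hz.1))
    rw [IntegrableOn, strip, Measure.volume_eq_prod, ← Measure.prod_restrict] at this
    exact this.integral_prod_right
  have hweak : IsWeakDerivOn (Ioi 0) (fun y => ∫ x in I, θ x • u (x, y))
      (fun y => ∫ x in I, θ x • w (x, y)) := fun ψ hψ hψc hψs => by
    beta_reduce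
    rw [← hfub h.integrableOn (contDiff_deriv hψ) hψc.deriv, ← hfub h.integrableOn_deriv hψ hψc]
    exact h.weakDeriv θ ψ hθ hψ hψc hψs
  refine ae_eq_zero_of_isWeakDerivOn hk (hi h.integrableOn) (hi h.integrableOn_deriv) hweak ?_ ?_
  · intro ψ hψ hψc hψs
    have e1 := hweak (deriv ψ) (contDiff_deriv hψ) hψc.deriv (tsupport_deriv_subset.trans hψs)
    beta_reduce at e1
    rw [← hfub h.integrableOn (contDiff_deriv (contDiff_deriv hψ)) hψc.deriv.deriv] at e1
    simp only [Pi.smul_apply, smul_comm _ (k ^ 2)]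
    rw [integral_smul, ← hfub h.integrableOn hψ hψc, ← hθ2 ψ hψ hψc]
    exact neg_injective (e1.symm.trans (h.laplace θ ψ hθ hθ0 hθ1 hψ hψc hψs))
  · intro β hβ hβ0
    have hdβ : ContDiff ℝ ∞ (deriv β) := contDiff_deriv hβ
    have hsub : strip (Ioo 0 1) ⊆ strip (Ioi 0) := prod_mono subset_rfl Ioo_subset_Ioi_self
    have hfub' : ∀ {f : ℝ × ℝ → X} {ψ : ℝ → ℝ}, IntegrableOn f (strip (Ioi 0)) →
        ContDiff ℝ ∞ ψ → ∫ z in strip (Ioo 0 1), (θ z.1 * ψ z.2) • f z =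
        ∫ y in Ioo 0 1, ψ y • ∫ x in I, θ x • f (x, y) := fun {f ψ} hf hψ =>
      setIntegral_tensor_symm (integrableOn_smul_rectangle (hf.mono_set hsub)
        ((hθ.continuous.comp continuous_fst).mul (hψ.continuous.comp continuous_snd)))
    have hi' : ∀ {f : ℝ × ℝ → X} {ψ : ℝ → ℝ}, IntegrableOn f (strip (Ioi 0)) → Continuous ψ →
        IntegrableOn (fun y => ψ y • ∫ x in I, θ x • f (x, y)) (Ioo 0 1) := fun {f ψ} hf hψ =>
      integrableOn_smul_of_subset_isCompact ((hi hf).mono_set Ioo_subset_Ioi_self)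
        measurableSet_Ioo hψ isCompact_Icc Ioo_subset_Icc_self
    rw [integral_add (hi' h.integrableOn_deriv hβ.continuous)
      (hi' h.integrableOn hdβ.continuous), ← hfub' h.integrableOn_deriv hβ,
      ← hfub' h.integrableOn hdβ, h.base θ β hθ hβ hβ0]
    simp

theorem deriv_sin_mul (n : ℕ) : deriv (fun x : ℝ => Real.sin (n * x)) =
    fun x => n * Real.cos (n * x) := by
  ext x
  simp [mul_comm]

theorem deriv_cos_mul (n : ℕ) : deriv (fun x : ℝ => Real.cos (n * x)) =
    fun x => -(n * Real.sin (n * x)) := by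
  ext x
  simp [mul_comm]

theorem IsIntegralSolution.ae_integral_sin_smul_eq_zero [CompleteSpace X] {u w : ℝ × ℝ → X}
    (h : IsIntegralSolution (fun _ => (0 : X)) u w) (n : ℕ) :
    ∀ᵐ y ∂volume.restrict (Ioi 0), ∫ x in I, Real.sin (n * x) • u (x, y) = 0 := by
  refine h.ae_integral_smul_eq_zero (by fun_prop) ?_ ?_ (Nat.cast_nonneg n) fun ψ _ _ => ?_
  · rw [← mul_assoc]
    exact_mod_cast Real.sin_nat_mul_pi (n * 2)
  · simp [deriv_sin_mul, Real.cos_nat_mul_two_pi n]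
  · rw [deriv_sin_mul, deriv_const_mul_field', deriv_cos_mul, ← integral_smul, ← integral_neg]
    refine integral_congr_ae (ae_of_all _ fun z => ?_)
    simp only
    module

/-- The function `(2π - x) cos nx` is only a root function: its second derivative contains the extra
term `2n sin nx`, which the vanishing sine coefficients annihilate. Hence `ae_integral_smul_eq_zero`
asks for `θ'' = -k²θ` only after pairing with `u`. -/
theorem IsIntegralSolution.ae_integral_cos_smul_eq_zero [CompleteSpace X] {u w : ℝ × ℝ → X}
    (h : IsIntegralSolution (fun _ => (0 : X)) u w) (n : ℕ) :
    ∀ᵐ y ∂volume.restrict (Ioi 0),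
      ∫ x in I, ((2 * Real.pi - x) * Real.cos (n * x)) • u (x, y) = 0 := by
  have hdlin : ∀ x : ℝ, HasDerivAt (fun x => 2 * Real.pi - x) (-1) x := fun x => by
    simpa using (hasDerivAt_id x).const_sub (2 * Real.pi)
  have hc : ∀ x : ℝ, HasDerivAt (fun x => Real.cos (n * x)) (-(n * Real.sin (n * x))) x :=
    fun x => by
    rw [← congrFun (deriv_cos_mul n) x, hasDerivAt_deriv_iff]
    fun_prop
  have hs : ∀ x : ℝ, HasDerivAt (fun x => Real.sin (n * x)) (n * Real.cos (n * x)) x :=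
    fun x => by
    rw [← congrFun (deriv_sin_mul n) x, hasDerivAt_deriv_iff]
    fun_prop
  have hd1 : deriv (fun x => (2 * Real.pi - x) * Real.cos (n * x)) = fun x =>
      -1 * Real.cos (n * x) + (2 * Real.pi - x) * -(n * Real.sin (n * x)) :=
    funext fun x => ((hdlin x).fun_mul (hc x)).deriv
  have hd2 : deriv (deriv (fun x => (2 * Real.pi - x) * Real.cos (n * x))) = fun x =>
      2 * n * Real.sin (n * x) - n ^ 2 * ((2 * Real.pi - x) * Real.cos (n * x)) := by
    rw [hd1]
    ext x
    rw [(((hc x).const_mul (-1)).fun_add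
      ((hdlin x).fun_mul (((hs x).const_mul (n : ℝ)).fun_neg))).deriv]
    ring
  refine h.ae_integral_smul_eq_zero (by fun_prop) (by simp) ?_ (Nat.cast_nonneg n)
    fun ψ hψ hψc => ?_
  · simp [hd1, Real.cos_nat_mul_two_pi n]
  have hint : ∀ {k : ℝ → ℝ}, Continuous k →
      IntegrableOn (fun z => (k z.1 * ψ z.2) • u z) (strip (Ioi 0)) := fun hk =>
    integrableOn_tensor_smul measurableSet_Ioi h.integrableOn hk hψ.continuous hψc
  have hsin : ∫ z in strip (Ioi 0), (Real.sin (n * z.1) * ψ z.2) • u z = 0 := by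
    rw [strip, setIntegral_tensor_symm (φ := fun x => Real.sin (n * x))
      (hint (k := fun x => Real.sin (n * x)) (by fun_prop))]
    refine integral_eq_zero_of_ae ?_
    filter_upwards [h.ae_integral_sin_smul_eq_zero n] with y hy
    rw [hy, smul_zero, Pi.zero_apply]
  have heq : ∀ z : ℝ × ℝ, ((2 * n * Real.sin (n * z.1) -
      n ^ 2 * ((2 * Real.pi - z.1) * Real.cos (n * z.1))) * ψ z.2) • u z =
      (2 * n : ℝ) • ((Real.sin (n * z.1) * ψ z.2) • u z) -
      (n ^ 2 : ℝ) • (((2 * Real.pi - z.1) * Real.cos (n * z.1) * ψ z.2) • u z) := fun z => by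
    module
  simp only [hd2, heq]
  have hi1 : IntegrableOn (fun z : ℝ × ℝ => (2 * n : ℝ) • ((Real.sin (n * z.1) * ψ z.2) • u z))
      (strip (Ioi 0)) :=
    (hint (k := fun x => Real.sin (n * x)) (by fun_prop)).smul (2 * n : ℝ)
  have hi2 : IntegrableOn (fun z : ℝ × ℝ => (n ^ 2 : ℝ) •
      (((2 * Real.pi - z.1) * Real.cos (n * z.1) * ψ z.2) • u z)) (strip (Ioi 0)) :=
    (hint (k := fun x => (2 * Real.pi - x) * Real.cos (n * x)) (by fun_prop)).smul (n ^ 2 : ℝ)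
  rw [integral_sub hi1 hi2,
    integral_smul, integral_smul, hsin, smul_zero, zero_sub]

theorem IsIntegralSolution.ae_eq_zero [CompleteSpace X] {u w : ℝ × ℝ → X}
    (h : IsIntegralSolution (fun _ => (0 : X)) u w) :
    ∀ᵐ z ∂volume.restrict (strip (Ioi 0)), u z = 0 := by
  have hu := h.integrableOn
  rw [IntegrableOn, strip, Measure.volume_eq_prod, ← Measure.prod_restrict] at hu
  -- The coefficients are countably many, so for almost every `y` all of them vanish simultaneously
  -- and totality applies to the slice.
  have hslice : ∀ᵐ y ∂volume.restrict (Ioi 0), ∀ᵐ x ∂volume.restrict I, u (x, y) = 0 := by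
    filter_upwards [hu.prod_left_ae, ae_all_iff.2 h.ae_integral_sin_smul_eq_zero,
      ae_all_iff.2 h.ae_integral_cos_smul_eq_zero] with y h1 h2 h3
    exact ae_eq_zero_of_forall_integral_eq_zero h1 h2 h3
  have hlint : ∫⁻ z, ‖u z‖ₑ ∂(volume.restrict I).prod (volume.restrict (Ioi 0)) = 0 := by
    rw [lintegral_prod_symm _ hu.1.enorm]
    refine (lintegral_congr_ae ?_).trans lintegral_zero
    filter_upwards [hslice] with y hy
    refine (lintegral_congr_ae ?_).trans lintegral_zero
    filter_upwards [hy] with x hx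
    rw [hx, enorm_zero]
  rw [lintegral_eq_zero_iff' hu.1.enorm] at hlint
  rw [strip, Measure.volume_eq_prod, ← Measure.prod_restrict]
  filter_upwards [hlint] with z hz
  exact enorm_eq_zero.1 hz

end BochnerStrip

theorem theorem4p1 {X : Type*} [NormedAddCommGroup X] [NormedSpace ℝ X] [CompleteSpace X]
    (p : ℝ≥0∞) (hp1 : 1 < p) (hp : p < ⊤) (f : ℝ → X)
    (hf : BochnerStrip.MemSobolevInterval 2 p f)
    (u₁ u₂ : ℝ × ℝ → X)
    (h₁ : BochnerStrip.IsSolution p f u₁) (h₂ : BochnerStrip.IsSolution p f u₂) :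
    ∀ᵐ z ∂(volume.restrict (BochnerStrip.strip (Ioi 0))), u₁ z = u₂ z := by
  obtain ⟨w₁, hw₁⟩ := h₁.exists_isIntegralSolution hp1.le
  obtain ⟨w₂, hw₂⟩ := h₂.exists_isIntegralSolution hp1.le
  filter_upwards [(hw₁.sub hw₂).ae_eq_zero] with z hz using sub_eq_zero.1 hz
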